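/- There is an absolute constant $C<\infty$ such that the following holds for the Stoch-Cost $k$-TSP problem. Let $V$ be a finite set with a (pseudo)metric $d$, let $\mathsf{root}\in V$, let $k$ be an integer with $0\le k\le |V|$, and let the vertices have independent random costs $C_v\in\mathbb{R}_{\ge 0}$ with known laws. A salesperson starts at $\mathsf{root}$ and walks from vertex to vertex; the value of $C_v$ is revealed when $v$ is first visited ($\mathsf{root}$ is visited at the start). A vertex can be selected only while the salesperson is at it. At every moment, whether to select the current vertex, whether to stop, and which vertex to go to next are determined (measurably) by the costs revealed so far. The walk ends after finitely many moves, with a return to $\mathsf{root}$, and it must have selected a set $S$ of exactly $k$ vertices. The expected cost of such an (adaptive) policy is $\mathbb{E}\big[d(\Pi)+\sum_{v\in S}C_v\big]\in[0,\infty]$, where $d(\Pi)$ is the length of the closed tour, and $\mathrm{OPT}$ is the infimum of the expected cost over all adaptive policies. A policy is non-adaptive if it visits vertices in the order of a finite list fixed in advance (repetitions allowed) until a stopping criterion is met, so that only the stopping time and the selection of visited vertices depend on the revealed costs. Then for every such instance there is a non-adaptive policy whose expected cost is at most $C\cdot \mathrm{OPT}$. -/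

import Mathlib

open scoped NNReal ENNReal

namespace StochCostTSP

/-- A deterministic (in general adaptive) policy of a salesperson who starts at `root` and walks in
a finite vertex set `V`.  The cost vector `c : V → ℝ≥0` is the realization of all the vertex costs;
`pos t c` is the vertex reached after `t` moves, `sel t c` says whether the salesperson, being at
the vertex `pos t c` at time `t`, selects that vertex, and `stopTime c` is the number of moves made
before the walk ends (and the salesperson returns to `root`).

The cost of a vertex is only revealed on visiting it: the field `nonanticipating` says that the
selection decision and the stopping decision at time `t`, and the next vertex `pos (t + 1)`, depend
only on the costs of the vertices visited at the times `0, …, t`. -/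
structure Policy (V : Type*) (root : V) where
  pos : ℕ → (V → ℝ≥0) → V
  sel : ℕ → (V → ℝ≥0) → Bool
  stopTime : (V → ℝ≥0) → ℕ
  pos_zero : ∀ c, pos 0 c = root
  nonanticipating : ∀ (t : ℕ) (c c' : V → ℝ≥0),
    (∀ s ≤ t, c (pos s c) = c' (pos s c)) →
      sel t c = sel t c' ∧ (stopTime c = t ↔ stopTime c' = t) ∧ pos (t + 1) c = pos (t + 1) c'
  measurable_pos : ∀ (t : ℕ) (v : V), MeasurableSet {c | pos t c = v}
  measurable_sel : ∀ t : ℕ, MeasurableSet {c | sel t c = true}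
  measurable_stopTime : ∀ t : ℕ, MeasurableSet {c | stopTime c = t}

namespace Policy

variable {V : Type*} {root : V}

/-- The set `S` of selected vertices: a vertex is selected only at a time when the salesperson is
at that vertex. -/
def selected [DecidableEq V] (P : Policy V root) (c : V → ℝ≥0) : Finset V :=
  {t ∈ Finset.range (P.stopTime c + 1) | P.sel t c = true}.image fun t => P.pos t c

/-- The length `d(Π)` of the closed tour: all the moves, and the return to the root. -/
noncomputable def tourLength [PseudoMetricSpace V] (P : Policy V root) (c : V → ℝ≥0) : ℝ≥0∞ :=
  (∑ t ∈ Finset.range (P.stopTime c), edist (P.pos t c) (P.pos (t + 1) c)) +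
    edist (P.pos (P.stopTime c) c) root

/-- The total cost `d(Π) + ∑ v ∈ S, C_v`. -/
noncomputable def totalCost [DecidableEq V] [PseudoMetricSpace V] (P : Policy V root)
    (c : V → ℝ≥0) : ℝ≥0∞ :=
  P.tourLength c + ∑ v ∈ P.selected c, (c v : ℝ≥0∞)

/-- The expected total cost when the vertex costs are independent, that of `v` with law `μ v`. -/
noncomputable def expectedCost [Fintype V] [DecidableEq V] [PseudoMetricSpace V] (P : Policy V root)
    (μ : V → MeasureTheory.Measure ℝ≥0) : ℝ≥0∞ :=
  ∫⁻ c, P.totalCost c ∂(MeasureTheory.Measure.pi μ)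

/-- The policy is a feasible solution for target `k`: it always selects a set of `k` vertices. -/
def Feasible [DecidableEq V] (P : Policy V root) (k : ℕ) : Prop :=
  ∀ c, (P.selected c).card = k

/-- The policy is non-adaptive: the vertices are visited in the order of a list fixed in advance
(starting at the root, repetitions allowed), until a stopping criterion is met.  Only the stopping
time and which of the visited vertices are selected may depend on the revealed costs. -/
def NonAdaptive (P : Policy V root) : Prop :=
  ∃ L : List V, ∀ (c : V → ℝ≥0) (t : ℕ), t ≤ P.stopTime c → (root :: L)[t]? = some (P.pos t c)

end Policy

/-- The optimum `OPT`: the infimum of the expected total cost over all adaptive policies. -/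
noncomputable def optCost {V : Type*} [Fintype V] [DecidableEq V] [PseudoMetricSpace V] (root : V)
    (k : ℕ) (μ : V → MeasureTheory.Measure ℝ≥0) : ℝ≥0∞ :=
  ⨅ (P : Policy V root) (_ : P.Feasible k), P.expectedCost μ

end StochCostTSP

/-!
# The adaptivity gap of the Stoch-Cost `k`-TSP problem is bounded

A given policy of expected cost `O(OPT)` is simulated in phases with geometrically growing budgets
`B`. In each phase a closed walk through a *fixed* set of vertices is appended to the tour, and the
tour ends as soon as `k` visited vertices have total cost `O(B)`. The budgets add up to a multiple
of the last one, so it suffices that each phase decreases the probability of not being done by a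
constant factor, up to a multiple of the probability that the given policy costs more than `B`
(`exists_phase`); since the budgets grow by a factor very close to `1`, summing up the resulting
recurrence (`sum_mul_le_of_recurrence`) gives the expected cost `O(OPT)`. The last phase visits all
of `V` and selects the `k` cheapest vertices, which cost no more than those of the given policy. If
`OPT = 0`, there is no scale to start from; then the vertices at distance `0` from the root suffice
almost surely.

In a phase, let `X` be the set of vertices visited so far. The number of vertices still missing
depends on the costs on `X`, but a fixed set of new vertices has to be chosen without looking at
them. For the conditional median `r` of this number, it is enough to find `r` cheap vertices outside
`X` with constant probability: these are independent of the costs on `X`, for which `r` suffices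
with probability one half. And for some costs on `X` that make `r` vertices necessary, the given
policy, aborted after a walk of length `B`, finds `r` cheap vertices outside `X` with probability
close to `1`. So the problem is reduced to the following (`exists_union_cheap`): if an adaptive
exploration, whose set of visited vertices always lies in a family `𝒯`, finds `r` vertices of total
cost at most `B` with probability close to `1`, then a union of boundedly many fixed members
of `𝒯` contains `r` vertices of total cost `O(B)` with constant probability.

For a threshold `t`, a vertex of cost `x` gets the reward `max 0 (1 - x / t)`, so that a successful
exploration collects a reward of at least `r - B / t`. The members of `𝒯` are chosen greedily with
respect to the mean rewards (`exists_greedy_cover`); let `W` be their union. By Wald's identity the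
exploration collects little reward outside `W`. Unless `W` contains `r` vertices of cost at most `t`
with constant probability, the reward of `W` and the number of its vertices of cost at most `t` are
therefore concentrated around `r`, so by the Paley–Zygmund inequality
(`sumVar_add_sq_le_of_concentrated`) their variances are of the order of the squared error. The
error involves the gain `g` of the greedy procedure, and `g` is bounded by `O(1 + B / t)` because,
by Chebyshev's inequality for the martingale of the exploration
(`Exploration.exists_sum_visited_le`), already the best single member of `𝒯` has mean reward close
to `r`. This is the alternative of `exists_union_affordable_or_concentrated`: `W` contains
`r ± O(B / t)` vertices of cost at most `t` on average, of expected total cost `O(B)`. At the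
threshold `2 B` the first alternative holds. If `t` is the largest of the thresholds `2 B / 2 ^ l`
for which it fails, the cheap vertices for `t` are completed to `r` vertices by `O(B / t)` vertices of
cost at most `2 t` found for the threshold `2 t`.
-/

namespace StochCostTSP

open MeasureTheory Function

/-! ### Independent coordinates -/

theorem measurable_sum_comp_eval {V : Type*} {ψ : V → ℝ≥0 → ℝ} (hψ : ∀ v, Measurable (ψ v))
    (W : Finset V) : Measurable fun c : V → ℝ≥0 => ∑ v ∈ W, ψ v (c v) :=
  Finset.measurable_sum _ fun v _ => (hψ v).comp (measurable_pi_apply v)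

theorem abs_sum_comp_eval_le {V : Type*} {ψ : V → ℝ≥0 → ℝ} (hb : ∀ v x, |ψ v x| ≤ 1)
    (W : Finset V) (c : V → ℝ≥0) : |∑ v ∈ W, ψ v (c v)| ≤ W.card := by
  refine (Finset.abs_sum_le_sum_abs _ _).trans ?_
  simpa using Finset.sum_le_sum fun v (_ : v ∈ W) => hb v (c v)

theorem sum_comp_update {V : Type*} [DecidableEq V] {ψ : V → ℝ≥0 → ℝ} {W : Finset V} {v : V}
    (hv : v ∉ W) (c : V → ℝ≥0) (x : ℝ≥0) :
    ∑ w ∈ W, ψ w (update c v x w) = ∑ w ∈ W, ψ w (c w) :=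
  Finset.sum_congr rfl fun w hw => by
    rw [update_of_ne]; rintro rfl; exact hv hw

theorem measurable_piecewise {V : Type*} [DecidableEq V] (X : Finset V) :
    Measurable fun z : (V → ℝ≥0) × (V → ℝ≥0) => X.piecewise z.1 z.2 := by
  refine measurable_pi_lambda _ fun v => ?_
  by_cases hv : v ∈ X
  · simp only [Finset.piecewise_eq_of_mem _ _ _ hv]; fun_prop
  · simp only [Finset.piecewise_eq_of_notMem _ _ _ hv]; fun_prop

section Product

variable {V : Type*} [Fintype V] [DecidableEq V] (μ : V → Measure ℝ≥0)
  [∀ v, IsProbabilityMeasure (μ v)]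

/-- Two independent copies of the cost vector, one used on `X` and the other one outside, make up a
cost vector with the same law. -/
theorem map_piecewise (X : Finset V) :
    ((Measure.pi μ).prod (Measure.pi μ)).map
      (fun z : (V → ℝ≥0) × (V → ℝ≥0) => X.piecewise z.1 z.2) = Measure.pi μ := by
  refine (Measure.pi_eq fun s hs => ?_).symm
  rw [Measure.map_apply (measurable_piecewise X) (MeasurableSet.univ_pi hs)]
  have : (fun z : (V → ℝ≥0) × (V → ℝ≥0) => X.piecewise z.1 z.2) ⁻¹' Set.univ.pi s =
      (Set.univ.pi fun v => if v ∈ X then s v else Set.univ) ×ˢ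
        (Set.univ.pi fun v => if v ∈ X then Set.univ else s v) := by
    ext z
    simp only [Set.mem_preimage, Set.mem_pi, Set.mem_univ, true_implies, Set.mem_prod,
      ← forall_and]
    refine forall_congr' fun v => ?_
    by_cases hv : v ∈ X <;> simp [hv]
  rw [this, Measure.prod_prod, Measure.pi_pi, Measure.pi_pi, ← Finset.prod_mul_distrib]
  refine Finset.prod_congr rfl fun v _ => ?_
  by_cases hv : v ∈ X <;> simp [hv]

/-- A function that ignores the cost of `v` is independent of that cost. -/
theorem integral_mul_comp_eval {v : V} {f : (V → ℝ≥0) → ℝ} (hf : Measurable f)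
    (hupd : ∀ c x, f (update c v x) = f c) {ψ : ℝ≥0 → ℝ} (hψ : Measurable ψ) :
    ∫ c, f c * ψ (c v) ∂Measure.pi μ = (∫ c, f c ∂Measure.pi μ) * ∫ x, ψ x ∂μ v := by
  have hm : Measurable fun c : V → ℝ≥0 => f c * ψ (c v) :=
    hf.mul (hψ.comp (measurable_pi_apply v))
  have h1 : ∫ x, ψ x ∂μ v = ∫ c, ψ (c v) ∂Measure.pi μ := by
    rw [← (measurePreserving_eval μ v).map_eq,
      integral_map (measurable_pi_apply v).aemeasurable hψ.aestronglyMeasurable]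
  conv_lhs => rw [← map_piecewise μ {v}]
  rw [integral_map (measurable_piecewise _).aemeasurable hm.aestronglyMeasurable, h1, mul_comm,
    ← integral_prod_mul]
  refine integral_congr_ae (.of_forall fun z => ?_)
  have : ({v} : Finset V).piecewise z.1 z.2 = update z.2 v (z.1 v) := by
    ext w; by_cases h : w = v
    · subst h; simp
    · simp [h]
  simp [this, hupd, mul_comm]

/-- Independence of the coordinates in `X` and of those outside `X`. -/
theorem measure_inter_of_piecewise (X : Finset V) {F G : Set (V → ℝ≥0)} (hF : MeasurableSet F)
    (hG : MeasurableSet G) (hFX : ∀ c c', X.piecewise c c' ∈ F ↔ c ∈ F)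
    (hGX : ∀ c c', X.piecewise c c' ∈ G ↔ c' ∈ G) :
    Measure.pi μ (F ∩ G) = Measure.pi μ F * Measure.pi μ G := by
  conv_lhs => rw [← map_piecewise μ X]
  rw [Measure.map_apply (measurable_piecewise X) (hF.inter hG), ← Measure.prod_prod]
  congr 1
  ext z
  simp [hFX, hGX]

theorem integrable_of_bounded {Ω : Type*} [MeasurableSpace Ω] {ν : Measure Ω} [IsFiniteMeasure ν]
    {f : Ω → ℝ} (hf : Measurable f) {K : ℝ} (hK : ∀ c, |f c| ≤ K) : Integrable f ν :=
  Integrable.of_bound hf.aestronglyMeasurable K (.of_forall hK)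

theorem integral_comp_eval {v : V} {ψ : ℝ≥0 → ℝ} (hψ : Measurable ψ) :
    ∫ c, ψ (c v) ∂Measure.pi μ = ∫ x, ψ x ∂μ v := by
  simpa using integral_mul_comp_eval μ (v := v) (f := fun _ => 1) measurable_const
    (fun _ _ => rfl) hψ

/-- First, second and fourth moments of a sum of independent centered variables bounded by `1`. -/
theorem moments_sum_centered {ψ : V → ℝ≥0 → ℝ} (hψ : ∀ v, Measurable (ψ v))
    (hb : ∀ v x, |ψ v x| ≤ 1) (h0 : ∀ v, ∫ x, ψ v x ∂μ v = 0) (W : Finset V) :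
    (∫ c, (∑ v ∈ W, ψ v (c v)) ∂Measure.pi μ) = 0 ∧
    (∫ c, (∑ v ∈ W, ψ v (c v)) ^ 2 ∂Measure.pi μ) = ∑ v ∈ W, ∫ x, ψ v x ^ 2 ∂μ v ∧
    (∫ c, (∑ v ∈ W, ψ v (c v)) ^ 4 ∂Measure.pi μ) ≤
      3 * (∑ v ∈ W, ∫ x, ψ v x ^ 2 ∂μ v) ^ 2 + ∑ v ∈ W, ∫ x, ψ v x ^ 2 ∂μ v := by
  classical
  induction W using Finset.induction_on with
  | empty => simp
  | insert v W hv ih =>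
    obtain ⟨ih1, ih2, ih4⟩ := ih
    set D : (V → ℝ≥0) → ℝ := fun c => ∑ v ∈ W, ψ v (c v) with hD
    have hDm : Measurable D := measurable_sum_comp_eval hψ W
    have hDb : ∀ c, |D c| ≤ W.card := abs_sum_comp_eval_le hb W
    have hDu : ∀ c x, D (update c v x) = D c := fun c x => sum_comp_update hv c x
    have key : ∀ i j : ℕ, ∫ c, D c ^ i * ψ v (c v) ^ j ∂Measure.pi μ =
        (∫ c, D c ^ i ∂Measure.pi μ) * ∫ x, ψ v x ^ j ∂μ v := fun i j =>
      integral_mul_comp_eval μ (f := fun c => D c ^ i) (ψ := fun x => ψ v x ^ j)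
        (hDm.pow_const i) (fun c x => by simp only [hDu]) ((hψ v).pow_const j)
    have int : ∀ i j : ℕ, Integrable (fun c => D c ^ i * ψ v (c v) ^ j) (Measure.pi μ) := by
      intro i j
      refine integrable_of_bounded (K := (W.card : ℝ) ^ i * 1 ^ j)
        ((hDm.pow_const i).mul (((hψ v).comp (measurable_pi_apply v)).pow_const j)) fun c => ?_
      rw [abs_mul, abs_pow, abs_pow]
      gcongr
      · exact hDb c
      · exact hb _ _
    have hq4 : ∫ x, ψ v x ^ 4 ∂μ v ≤ ∫ x, ψ v x ^ 2 ∂μ v := by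
      refine integral_mono
        (integrable_of_bounded (K := 1) ((hψ v).pow_const 4) fun x => ?_)
        (integrable_of_bounded (K := 1) ((hψ v).pow_const 2) fun x => ?_) fun x => ?_
      · rw [abs_pow]; exact pow_le_one₀ (abs_nonneg _) (hb v x)
      · rw [abs_pow]; exact pow_le_one₀ (abs_nonneg _) (hb v x)
      · have h1 : ψ v x ^ 2 ≤ 1 := by
          rw [← sq_abs]; exact pow_le_one₀ (abs_nonneg _) (hb v x)
        have h2 := sq_nonneg (ψ v x)
        show ψ v x ^ 4 ≤ ψ v x ^ 2
        nlinarith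
    have hq0 : 0 ≤ ∫ x, ψ v x ^ 2 ∂μ v := integral_nonneg fun x => sq_nonneg _
    have hQ0 : 0 ≤ ∑ v ∈ W, ∫ x, ψ v x ^ 2 ∂μ v :=
      Finset.sum_nonneg fun v _ => integral_nonneg fun x => sq_nonneg _
    have ih2' : ∫ c, D c ^ 2 ∂Measure.pi μ = ∑ v ∈ W, ∫ x, ψ v x ^ 2 ∂μ v := ih2
    have binom : ∀ n : ℕ, ∫ c, (ψ v (c v) + D c) ^ n ∂Measure.pi μ = ∑ m ∈ Finset.range (n + 1),
        (∫ c, D c ^ m ∂Measure.pi μ) * (∫ x, ψ v x ^ (n - m) ∂μ v) * (n.choose m : ℝ) := by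
      intro n
      have : ∀ c : V → ℝ≥0, (ψ v (c v) + D c) ^ n = ∑ m ∈ Finset.range (n + 1),
          D c ^ m * ψ v (c v) ^ (n - m) * (n.choose m : ℝ) := fun c => by rw [add_comm, add_pow]
      rw [integral_congr_ae (.of_forall this),
        integral_finsetSum _ fun m _ => (int m (n - m)).mul_const _]
      exact Finset.sum_congr rfl fun m _ => by rw [integral_mul_const, key]
    simp only [Finset.sum_insert hv]
    refine ⟨?_, ?_, ?_⟩
    · simpa [Finset.sum_range_succ, h0, ih1] using binom 1
    · rw [binom 2]
      simp [Finset.sum_range_succ, h0, ih1, ih2']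
    · rw [binom 4]
      simp only [Finset.sum_range_succ, Finset.sum_range_zero, pow_zero, integral_const,
        probReal_univ, smul_eq_mul, pow_one, one_mul, h0, ih1, ih2', mul_zero, zero_mul, mul_one,
        zero_add, add_zero, Nat.sub_zero, Nat.choose_zero_right, Nat.cast_one, Nat.choose_self,
        show 4 - 3 = 1 from rfl, show 4 - 2 = 2 from rfl, show Nat.choose 4 2 = 6 from rfl,
        Nat.sub_self]
      push_cast
      nlinarith [sq_nonneg (∫ x, ψ v x ^ 2 ∂μ v)]

end Product

/-! ### Anticoncentration of sums of independent variables -/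

section Anticoncentration

variable {V : Type*}

/-- The sum over `W` of the variances of the variables `φ v (c v)`. -/
noncomputable def sumVar (μ : V → Measure ℝ≥0) (φ : V → ℝ≥0 → ℝ) (W : Finset V) : ℝ :=
  ∑ v ∈ W, ∫ x, (φ v x - ∫ y, φ v y ∂μ v) ^ 2 ∂μ v

/-- The sum over `W` of the means of the variables `φ v (c v)`. -/
noncomputable def sumMean (μ : V → Measure ℝ≥0) (φ : V → ℝ≥0 → ℝ) (W : Finset V) : ℝ :=
  ∑ v ∈ W, ∫ x, φ v x ∂μ v

variable {μ : V → Measure ℝ≥0} {φ : V → ℝ≥0 → ℝ}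

theorem sumVar_nonneg (W : Finset V) : 0 ≤ sumVar μ φ W :=
  Finset.sum_nonneg fun _ _ => integral_nonneg fun _ => sq_nonneg _

variable [∀ v, IsProbabilityMeasure (μ v)]

theorem mean_mem_Icc {v : V} (hφ : Measurable (φ v)) (hI : ∀ x, φ v x ∈ Set.Icc (0 : ℝ) 1) :
    ∫ x, φ v x ∂μ v ∈ Set.Icc (0 : ℝ) 1 := by
  refine ⟨integral_nonneg fun x => (hI x).1, ?_⟩
  have h : ∫ x, φ v x ∂μ v ≤ ∫ _, (1 : ℝ) ∂μ v :=
    integral_mono (integrable_of_bounded (K := 1) hφ fun x => by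
      rw [abs_of_nonneg (hI x).1]; exact (hI x).2) (integrable_const _) fun x => (hI x).2
  simpa using h

theorem abs_centered_le {v : V} (hφ : Measurable (φ v)) (hI : ∀ x, φ v x ∈ Set.Icc (0 : ℝ) 1)
    (x : ℝ≥0) : |φ v x - ∫ y, φ v y ∂μ v| ≤ 1 := by
  have h1 := mean_mem_Icc (μ := μ) hφ hI
  have h2 := hI x
  rw [abs_le]
  exact ⟨by linarith [h1.2, h2.1], by linarith [h1.1, h2.2]⟩

theorem integral_centered {v : V} (hφ : Measurable (φ v)) (hI : ∀ x, φ v x ∈ Set.Icc (0 : ℝ) 1) :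
    ∫ x, (φ v x - ∫ y, φ v y ∂μ v) ∂μ v = 0 := by
  rw [integral_sub (integrable_of_bounded (K := 1) hφ fun x => by
      rw [abs_of_nonneg (hI x).1]; exact (hI x).2) (integrable_const _)]
  simp

/-- The variance of a `[0, 1]`-valued variable is at most its mean. -/
theorem variance_le_mean {v : V} (hφ : Measurable (φ v)) (hI : ∀ x, φ v x ∈ Set.Icc (0 : ℝ) 1) :
    ∫ x, (φ v x - ∫ y, φ v y ∂μ v) ^ 2 ∂μ v ≤ ∫ x, φ v x ∂μ v := by
  set m := ∫ y, φ v y ∂μ v with hm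
  have i1 : Integrable (φ v) (μ v) := integrable_of_bounded (K := 1) hφ fun x => by
      rw [abs_of_nonneg (hI x).1]; exact (hI x).2
  have i3 : Integrable (fun x => φ v x - 2 * m * φ v x) (μ v) := i1.sub (i1.const_mul _)
  have i2 : Integrable (fun x => φ v x - 2 * m * φ v x + m ^ 2) (μ v) :=
    i3.add (integrable_const _)
  have h1 : ∫ x, (φ v x - m) ^ 2 ∂μ v ≤ ∫ x, (φ v x - 2 * m * φ v x + m ^ 2) ∂μ v := by
    refine integral_mono (integrable_of_bounded (K := 1) ((hφ.sub_const m).pow_const 2)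
      fun x => ?_) i2 fun x => ?_
    · rw [abs_pow]; exact pow_le_one₀ (abs_nonneg _) (abs_centered_le hφ hI x)
    · have := hI x
      show (φ v x - m) ^ 2 ≤ φ v x - 2 * m * φ v x + m ^ 2
      nlinarith [this.1, this.2]
  have h2 : ∫ x, (φ v x - 2 * m * φ v x + m ^ 2) ∂μ v = m - 2 * m * m + m ^ 2 := by
    rw [integral_add i3 (integrable_const _),
      integral_sub i1 (i1.const_mul _), integral_const_mul, ← hm]
    simp
  nlinarith [sq_nonneg m]

variable [Fintype V] [DecidableEq V]

/-- Mean squared deviation from a point `y` = variance + squared bias. -/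
theorem integral_sub_sq (hφ : ∀ v, Measurable (φ v)) (hI : ∀ v x, φ v x ∈ Set.Icc (0 : ℝ) 1)
    (W : Finset V) (y : ℝ) :
    ∫ c, (∑ v ∈ W, φ v (c v) - y) ^ 2 ∂Measure.pi μ =
      sumVar μ φ W + (sumMean μ φ W - y) ^ 2 := by
  set ψ : V → ℝ≥0 → ℝ := fun v x => φ v x - ∫ z, φ v z ∂μ v with hψ
  have hψm : ∀ v, Measurable (ψ v) := fun v => (hφ v).sub_const _
  have hψb : ∀ v x, |ψ v x| ≤ 1 := fun v x => abs_centered_le (hφ v) (hI v) x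
  obtain ⟨h1, h2, -⟩ := moments_sum_centered μ hψm hψb
    (fun v => integral_centered (hφ v) (hI v)) W
  have hDm := measurable_sum_comp_eval hψm W
  have hDb := abs_sum_comp_eval_le hψb W
  set D : (V → ℝ≥0) → ℝ := fun c => ∑ v ∈ W, ψ v (c v) with hD
  set d := sumMean μ φ W - y with hd
  have e : ∀ c : V → ℝ≥0, (∑ v ∈ W, φ v (c v) - y) ^ 2 = D c ^ 2 + 2 * d * D c + d ^ 2 := by
    intro c
    have : ∑ v ∈ W, φ v (c v) = D c + sumMean μ φ W := by
      simp [hD, hψ, sumMean]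
    rw [this, hd]; ring
  have i1 : Integrable D (Measure.pi μ) := integrable_of_bounded hDm hDb
  have i2 : Integrable (fun c => D c ^ 2) (Measure.pi μ) :=
    integrable_of_bounded (K := (W.card : ℝ) ^ 2) (hDm.pow_const 2) fun c => by
      rw [abs_pow]; exact pow_le_pow_left₀ (abs_nonneg _) (hDb c) 2
  have i3 : Integrable (fun c => D c ^ 2 + 2 * d * D c) (Measure.pi μ) := i2.add (i1.const_mul _)
  rw [integral_congr_ae (.of_forall e), integral_add i3 (integrable_const _),
    integral_add i2 (i1.const_mul _), integral_const_mul, h1, h2]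
  simp [sumVar, hψ]

theorem integral_sub_pow_four_le (hφ : ∀ v, Measurable (φ v))
    (hI : ∀ v x, φ v x ∈ Set.Icc (0 : ℝ) 1) (W : Finset V) (y : ℝ) :
    ∫ c, (∑ v ∈ W, φ v (c v) - y) ^ 4 ∂Measure.pi μ ≤
      8 * (3 * sumVar μ φ W ^ 2 + sumVar μ φ W + (sumMean μ φ W - y) ^ 4) := by
  set ψ : V → ℝ≥0 → ℝ := fun v x => φ v x - ∫ z, φ v z ∂μ v with hψ
  have hψm : ∀ v, Measurable (ψ v) := fun v => (hφ v).sub_const _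
  have hψb : ∀ v x, |ψ v x| ≤ 1 := fun v x => abs_centered_le (hφ v) (hI v) x
  obtain ⟨-, -, h4⟩ := moments_sum_centered μ hψm hψb
    (fun v => integral_centered (hφ v) (hI v)) W
  have hDm := measurable_sum_comp_eval hψm W
  have hDb := abs_sum_comp_eval_le hψb W
  set D : (V → ℝ≥0) → ℝ := fun c => ∑ v ∈ W, ψ v (c v) with hD
  set d := sumMean μ φ W - y with hd
  have e : ∀ c : V → ℝ≥0, ∑ v ∈ W, φ v (c v) - y = D c + d := by
    intro c
    simp [hD, hψ, sumMean, hd]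
  have i4 : Integrable (fun c => D c ^ 4) (Measure.pi μ) :=
    integrable_of_bounded (K := (W.card : ℝ) ^ 4) (hDm.pow_const 4) fun c => by
      rw [abs_pow]; exact pow_le_pow_left₀ (abs_nonneg _) (hDb c) 4
  simp only [e]
  calc ∫ c, (D c + d) ^ 4 ∂Measure.pi μ ≤ ∫ c, 8 * (D c ^ 4 + d ^ 4) ∂Measure.pi μ := by
        refine integral_mono_of_nonneg (.of_forall fun c => by positivity)
          ((i4.add (integrable_const _)).const_mul _) (.of_forall fun c => ?_)
        show (D c + d) ^ 4 ≤ 8 * (D c ^ 4 + d ^ 4)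
        nlinarith [sq_nonneg (D c ^ 2 - d ^ 2), sq_nonneg (D c - d), sq_nonneg ((D c - d) ^ 2),
          sq_nonneg (D c + d), mul_nonneg (sq_nonneg (D c - d)) (sq_nonneg (D c + d)),
          mul_nonneg (sq_nonneg (D c - d)) (sq_nonneg (D c)),
          mul_nonneg (sq_nonneg (D c - d)) (sq_nonneg d)]
    _ = 8 * ((∫ c, D c ^ 4 ∂Measure.pi μ) + d ^ 4) := by
        rw [integral_const_mul, integral_add i4 (integrable_const _)]
        simp
    _ ≤ _ := by
        simp only [sumVar]
        have : (∫ c, D c ^ 4 ∂Measure.pi μ) ≤ 3 * (∑ v ∈ W, ∫ x, ψ v x ^ 2 ∂μ v) ^ 2 +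
          ∑ v ∈ W, ∫ x, ψ v x ^ 2 ∂μ v := h4
        linarith

/-- Anticoncentration, by Paley and Zygmund: if a sum of independent `[0, 1]`-valued variables is
within `ℓ` of `y` with probability close to `1`, then its variance and its bias are of order at most
`ℓ²`. -/
theorem sumVar_add_sq_le_of_concentrated (hφ : ∀ v, Measurable (φ v))
    (hI : ∀ v x, φ v x ∈ Set.Icc (0 : ℝ) 1) (W : Finset V) (y ℓ : ℝ)
    (hP : 127 / 128 < (Measure.pi μ).real {c | |∑ v ∈ W, φ v (c v) - y| ≤ ℓ}) :
    sumVar μ φ W + (sumMean μ φ W - y) ^ 2 ≤ 1 + 2 * ℓ ^ 2 := by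
  by_contra! hq
  have e2 := integral_sub_sq (μ := μ) hφ hI W y
  have e4 := integral_sub_pow_four_le (μ := μ) hφ hI W y
  have hSm := measurable_sum_comp_eval hφ W
  have hSb := abs_sum_comp_eval_le (ψ := φ) (fun v x => by
    rw [abs_of_nonneg (hI v x).1]; exact (hI v x).2) W
  have hQ := sumVar_nonneg (μ := μ) (φ := φ) W
  set S : (V → ℝ≥0) → ℝ := fun c => ∑ v ∈ W, φ v (c v) with hS
  set Q := sumVar μ φ W with hQd
  set d := sumMean μ φ W - y with hd
  set q := Q + d ^ 2 with hqd
  set H : Set (V → ℝ≥0) := {c | |S c - y| ≤ ℓ} with hH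
  have hHm : MeasurableSet H := measurableSet_le ((hSm.sub_const y).abs) measurable_const
  have hq1 : 1 < q := by nlinarith [sq_nonneg ℓ]
  have h4 : ∫ c, (S c - y) ^ 4 ∂Measure.pi μ ≤ 32 * q ^ 2 := by
    refine e4.trans ?_
    have h1 : Q ≤ Q * q := by nlinarith
    have h2 : 0 ≤ Q * d ^ 2 := by positivity
    have h3 : d ^ 4 = (d ^ 2) ^ 2 := by ring
    rw [h3]
    have h5 : Q * q = Q ^ 2 + Q * d ^ 2 := by rw [hqd]; ring
    have h6 : q ^ 2 = Q ^ 2 + 2 * (Q * d ^ 2) + (d ^ 2) ^ 2 := by rw [hqd]; ring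
    nlinarith [sq_nonneg (d ^ 2)]
  have iS : ∀ n, Integrable (fun c => (S c - y) ^ n) (Measure.pi μ) := fun n =>
    integrable_of_bounded (K := ((W.card : ℝ) + |y|) ^ n) ((hSm.sub_const y).pow_const n)
      fun c => by
      rw [abs_pow]
      exact pow_le_pow_left₀ (abs_nonneg _) ((abs_sub _ _).trans (by gcongr; exact hSb c)) n
  have iH : Integrable (Hᶜ.indicator fun _ => (1 : ℝ)) (Measure.pi μ) :=
    (integrable_const _).indicator hHm.compl
  have h2 : q ≤ ∫ c, (q / 2 + ((S c - y) ^ 4 / (64 * q) +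
      64 * q * Hᶜ.indicator (fun _ => (1 : ℝ)) c) / 2) ∂Measure.pi μ := by
    refine e2.symm.le.trans (integral_mono (iS 2) ((integrable_const _).add
      ((((iS 4).div_const _).add (iH.const_mul _)).div_const _)) fun c => ?_)
    show (S c - y) ^ 2 ≤ q / 2 + ((S c - y) ^ 4 / (64 * q) +
      64 * q * Hᶜ.indicator (fun _ => (1 : ℝ)) c) / 2
    have h40 : 0 ≤ (S c - y) ^ 4 / (64 * q) := by positivity
    by_cases hc : c ∈ H
    · have hc' : |S c - y| ≤ ℓ := hc
      have : (S c - y) ^ 2 ≤ ℓ ^ 2 := by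
        rw [← sq_abs]; exact pow_le_pow_left₀ (abs_nonneg _) hc' 2
      have hi : Hᶜ.indicator (fun _ => (1 : ℝ)) c = 0 := by simp [hc]
      rw [hi]; linarith
    · have hi : Hᶜ.indicator (fun _ => (1 : ℝ)) c = 1 := by simp [hc]
      rw [hi]
      have : 2 * (S c - y) ^ 2 ≤ (S c - y) ^ 4 / (64 * q) + 64 * q := by
        rw [div_add' _ _ _ (by positivity), le_div_iff₀ (by positivity)]
        nlinarith [sq_nonneg ((S c - y) ^ 2 - 64 * q)]
      linarith
  have i5 : Integrable (fun c => (S c - y) ^ 4 / (64 * q) +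
      64 * q * Hᶜ.indicator (fun _ => (1 : ℝ)) c) (Measure.pi μ) :=
    ((iS 4).div_const _).add (iH.const_mul _)
  rw [integral_add (integrable_const _) (i5.div_const _), integral_div, integral_div,
    integral_add ((iS 4).div_const _) (iH.const_mul _), integral_div,
    integral_const_mul, integral_indicator_const _ hHm.compl, probReal_compl_eq_one_sub hHm] at h2
  simp only [integral_const, probReal_univ, smul_eq_mul, one_mul, mul_one] at h2
  have h5 : (∫ c, (S c - y) ^ 4 ∂Measure.pi μ) / (64 * q) ≤ q / 2 := by
    rw [div_le_iff₀ (by positivity)]; nlinarith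
  nlinarith

theorem integral_sum_comp_eval (hφ : ∀ v, Measurable (φ v))
    (hI : ∀ v x, φ v x ∈ Set.Icc (0 : ℝ) 1) (W : Finset V) :
    ∫ c, ∑ v ∈ W, φ v (c v) ∂Measure.pi μ = sumMean μ φ W := by
  rw [integral_finsetSum]
  · exact Finset.sum_congr rfl fun v _ => integral_comp_eval μ (hφ v)
  · exact fun v _ => integrable_of_bounded (K := 1) ((hφ v).comp (measurable_pi_apply v))
      fun c => by
      rw [abs_of_nonneg (hI _ _).1]; exact (hI _ _).2

/-- A mean squared deviation of at most `κ ^ 2` gives a mean absolute deviation of at most `κ`. -/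
theorem integral_abs_sum_sub_le (hφ : ∀ v, Measurable (φ v))
    (hI : ∀ v x, φ v x ∈ Set.Icc (0 : ℝ) 1) (W : Finset V) {y κ : ℝ} (hκ : 0 < κ)
    (h : sumVar μ φ W + (sumMean μ φ W - y) ^ 2 ≤ κ ^ 2) :
    ∫ c, |∑ v ∈ W, φ v (c v) - y| ∂Measure.pi μ ≤ κ := by
  have hb := abs_sum_comp_eval_le (ψ := φ) (fun v x => by
    rw [abs_of_nonneg (hI v x).1]; exact (hI v x).2) W
  have hm := (measurable_sum_comp_eval hφ W).sub_const y
  have hb' : ∀ c : V → ℝ≥0, |∑ v ∈ W, φ v (c v) - y| ≤ W.card + |y| := fun c =>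
    (abs_sub _ _).trans (by gcongr; exact hb c)
  have i1 : Integrable (fun c : V → ℝ≥0 => |∑ v ∈ W, φ v (c v) - y|) (Measure.pi μ) :=
    (integrable_of_bounded hm hb').abs
  have i2 : Integrable (fun c : V → ℝ≥0 => (∑ v ∈ W, φ v (c v) - y) ^ 2) (Measure.pi μ) :=
    integrable_of_bounded (hm.pow_const 2) fun c => by
      rw [abs_pow]; exact pow_le_pow_left₀ (abs_nonneg _) (hb' c) 2
  have i3 : Integrable (fun c : V → ℝ≥0 => (∑ v ∈ W, φ v (c v) - y) ^ 2 / κ + κ) (Measure.pi μ) :=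
    (i2.div_const _).add (integrable_const _)
  have h3 : ∫ c, |∑ v ∈ W, φ v (c v) - y| ∂Measure.pi μ ≤
      ∫ c, ((∑ v ∈ W, φ v (c v) - y) ^ 2 / κ + κ) / 2 ∂Measure.pi μ := by
    refine integral_mono i1 (i3.div_const _) fun c => ?_
    show |∑ v ∈ W, φ v (c v) - y| ≤ ((∑ v ∈ W, φ v (c v) - y) ^ 2 / κ + κ) / 2
    generalize ∑ v ∈ W, φ v (c v) - y = z
    rw [← sq_abs, le_div_iff₀ two_pos, div_add' _ _ _ hκ.ne', le_div_iff₀ hκ]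
    nlinarith [sq_nonneg (|z| - κ)]
  rw [integral_div, integral_add (i2.div_const _) (integrable_const _), integral_div,
    integral_sub_sq hφ hI] at h3
  simp only [integral_const, probReal_univ, smul_eq_mul, one_mul] at h3
  have h4 : (sumVar μ φ W + (sumMean μ φ W - y) ^ 2) / κ ≤ κ := by
    rw [div_le_iff₀ hκ]; nlinarith
  linarith

end Anticoncentration

/-! ### Greedy covers and adaptive explorations -/

section Greedy

variable {V : Type*} [DecidableEq V]

theorem sum_sdiff_mono {w : V → ℝ} (hw : ∀ v, 0 ≤ w v) (A : Finset V) {X Y : Finset V}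
    (h : X ⊆ Y) : ∑ v ∈ A \ Y, w v ≤ ∑ v ∈ A \ X, w v :=
  Finset.sum_le_sum_of_subset_of_nonneg (Finset.sdiff_subset_sdiff subset_rfl h) fun v _ _ => hw v

/-- Greedy covering. A member `T₁` of the family with maximal weight is extended, `K + 1` times, by
the member that adds the most weight. If `g` is the weight gained by the extensions, then outside
`T₁` every member weighs at most `g`, and outside the union `W` at most `g / K`. -/
theorem exists_greedy_cover (𝒯 : Finset (Finset V)) (h𝒯 : 𝒯.Nonempty) {w : V → ℝ}
    (hw : ∀ v, 0 ≤ w v) (K : ℕ) :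
    ∃ T₁ ∈ 𝒯, (∀ A ∈ 𝒯, ∑ v ∈ A, w v ≤ ∑ v ∈ T₁, w v) ∧ ∃ F ⊆ 𝒯, F.card ≤ K + 2 ∧
      T₁ ⊆ F.biUnion id ∧ ∀ A ∈ 𝒯,
        ∑ v ∈ A \ T₁, w v ≤ ∑ v ∈ F.biUnion id, w v - ∑ v ∈ T₁, w v ∧
        K * ∑ v ∈ A \ F.biUnion id, w v ≤ ∑ v ∈ F.biUnion id, w v - ∑ v ∈ T₁, w v := by
  obtain ⟨T₁, hT₁, hmax⟩ := 𝒯.exists_max_image (fun A => ∑ v ∈ A, w v) h𝒯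
  refine ⟨T₁, hT₁, hmax, ?_⟩
  -- adding the best member `T` to the union `X` raises its weight by that of `T \ X`
  have add : ∀ F : Finset (Finset V), ∀ T, ∑ v ∈ (insert T F).biUnion id, w v =
      ∑ v ∈ F.biUnion id, w v + ∑ v ∈ T \ F.biUnion id, w v := by
    intro F T
    rw [Finset.biUnion_insert, id, Finset.union_comm, ← Finset.union_sdiff_self_eq_union,
      Finset.sum_union Finset.disjoint_sdiff]
  induction K with
  | zero =>
    obtain ⟨T₂, hT₂, hmax₂⟩ := 𝒯.exists_max_image (fun A => ∑ v ∈ A \ T₁, w v) h𝒯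
    refine ⟨{T₂, T₁}, by simp [Finset.insert_subset_iff, hT₁, hT₂], Finset.card_le_two, by simp,
      fun A hA => ?_⟩
    have h := add {T₁} T₂
    simp only [Finset.singleton_biUnion, id] at h
    have h0 : 0 ≤ ∑ v ∈ T₂ \ T₁, w v := Finset.sum_nonneg fun v _ => hw v
    rw [h]
    exact ⟨by linarith [hmax₂ A hA], by simp; linarith⟩
  | succ K ih =>
    obtain ⟨F, hF, hcard, hsub, h⟩ := ih
    obtain ⟨T, hT, hTmax⟩ := 𝒯.exists_max_image (fun A => ∑ v ∈ A \ F.biUnion id, w v) h𝒯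
    have hmono : F.biUnion id ⊆ (insert T F).biUnion id := by
      rw [Finset.biUnion_insert]; exact Finset.subset_union_right
    refine ⟨insert T F, Finset.insert_subset hT hF, (Finset.card_insert_le _ _).trans (by omega),
      hsub.trans hmono, fun A hA => ?_⟩
    have h0 : 0 ≤ ∑ v ∈ T \ F.biUnion id, w v := Finset.sum_nonneg fun v _ => hw v
    have h1 := h A hA
    have h2 := sum_sdiff_mono hw A hmono
    have h3 := hTmax A hA
    rw [add F T]
    refine ⟨by linarith [h1.1], ?_⟩
    push_cast
    have h4 : (K : ℝ) * ∑ v ∈ A \ (insert T F).biUnion id, w v ≤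
        K * ∑ v ∈ A \ F.biUnion id, w v := by gcongr
    linarith [h1.2]

end Greedy

/-- The set of vertices inspected by an adaptive exploration. Whether `v` is inspected does not
depend on the cost of `v`; and `before c v w` (which stands for: both are inspected, `v` earlier
than `w`) does not depend on the cost of `w`. These two properties replace the time structure. -/
structure Exploration (V : Type*) [DecidableEq V] where
  visited : (V → ℝ≥0) → Finset V
  before : (V → ℝ≥0) → V → V → Prop
  measurableSet_visited : ∀ v, MeasurableSet {c | v ∈ visited c}
  measurableSet_before : ∀ v w, MeasurableSet {c | before c v w}
  visited_update : ∀ c v x, v ∈ visited (update c v x) ↔ v ∈ visited c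
  before_update : ∀ c v w x, v ≠ w → (before (update c w x) v w ↔ before c v w)
  visited_iff : ∀ c v w, v ≠ w → ((v ∈ visited c ∧ w ∈ visited c) ↔ (before c v w ∨ before c w v))
  not_before : ∀ c v w, v ≠ w → before c v w → ¬ before c w v

namespace Exploration

variable {V : Type*} [DecidableEq V] (E : Exploration V)

theorem measurable_indicator_visited (v : V) :
    Measurable ({c | v ∈ E.visited c}.indicator (1 : (V → ℝ≥0) → ℝ)) :=
  measurable_one.indicator (E.measurableSet_visited v)

variable [Fintype V] {μ : V → Measure ℝ≥0} [∀ v, IsProbabilityMeasure (μ v)]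

theorem sum_visited_eq (f : V → ℝ) (c : V → ℝ≥0) (X : Finset V) :
    ∑ v ∈ E.visited c \ X, f v = ∑ v ∈ Xᶜ, {c | v ∈ E.visited c}.indicator 1 c * f v := by
  classical
  rw [show E.visited c \ X = Xᶜ.filter fun v => v ∈ E.visited c by ext; simp [and_comm],
    Finset.sum_filter]
  exact Finset.sum_congr rfl fun v _ => by by_cases h : v ∈ E.visited c <;> simp [h]

theorem measurable_sum_visited {φ : V → ℝ≥0 → ℝ} (hφ : ∀ v, Measurable (φ v)) (X : Finset V) :
    Measurable fun c : V → ℝ≥0 => ∑ v ∈ E.visited c \ X, φ v (c v) := by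
  simp only [E.sum_visited_eq (fun v => φ v _)]
  exact Finset.measurable_sum _ fun v _ => (E.measurable_indicator_visited v).mul
    ((hφ v).comp (measurable_pi_apply v))

theorem abs_sum_visited_le {φ : V → ℝ≥0 → ℝ} (hb : ∀ v x, |φ v x| ≤ 1) (X : Finset V)
    (c : V → ℝ≥0) : |∑ v ∈ E.visited c \ X, φ v (c v)| ≤ Fintype.card V :=
  (abs_sum_comp_eval_le hb _ c).trans (by exact_mod_cast Finset.card_le_univ _)

/-- Wald's identity: in expectation, the inspected values sum up to their means. -/
theorem integral_sum_visited {φ : V → ℝ≥0 → ℝ} (hφ : ∀ v, Measurable (φ v))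
    (hb : ∀ v x, |φ v x| ≤ 1) (X : Finset V) :
    ∫ c, (∑ v ∈ E.visited c \ X, φ v (c v)) ∂Measure.pi μ =
      ∫ c, (∑ v ∈ E.visited c \ X, ∫ x, φ v x ∂μ v) ∂Measure.pi μ := by
  have hi : ∀ v, ∀ f : V → ℝ≥0 → ℝ, (∀ v, Measurable (f v)) → (∀ v x, |f v x| ≤ 1) →
      Integrable (fun c => {c | v ∈ E.visited c}.indicator 1 c * f v (c v)) (Measure.pi μ) := by
    intro v f hf hfb
    refine integrable_of_bounded (K := 1) ((E.measurable_indicator_visited v).mul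
      ((hf v).comp (measurable_pi_apply v))) fun c => ?_
    by_cases h : v ∈ E.visited c <;> simp [h, hfb]
  have hm : ∀ v, |∫ x, φ v x ∂μ v| ≤ 1 := fun v =>
    (abs_integral_le_integral_abs).trans <| by
      simpa using integral_mono (μ := μ v) (f := fun x => |φ v x|) (g := fun _ => (1 : ℝ))
        (integrable_of_bounded (K := 1) (hφ v).abs fun x => by simpa using hb v x)
        (integrable_const _) (hb v)
  simp only [E.sum_visited_eq (fun v => φ v _), E.sum_visited_eq (fun v => ∫ x, φ v x ∂μ v)]
  rw [integral_finsetSum _ fun v _ => hi v φ hφ hb,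
    integral_finsetSum _ fun v _ => hi v (fun v _ => ∫ x, φ v x ∂μ v)
      (fun _ => measurable_const) fun v _ => hm v]
  refine Finset.sum_congr rfl fun v _ => ?_
  rw [integral_mul_comp_eval μ (E.measurable_indicator_visited v) _ (hφ v), integral_mul_const]
  intro c x
  simp only [Set.indicator_apply, Set.mem_ofPred_eq, Pi.one_apply, E.visited_update]

/-- Orthogonality of the increments: the sum of the inspected centered values has the expected
sum of the inspected variances as its second moment. -/
theorem integral_sum_visited_sq {ψ : V → ℝ≥0 → ℝ} (hψ : ∀ v, Measurable (ψ v))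
    (hb : ∀ v x, |ψ v x| ≤ 1) (h0 : ∀ v, ∫ x, ψ v x ∂μ v = 0) :
    ∫ c, (∑ v ∈ E.visited c, ψ v (c v)) ^ 2 ∂Measure.pi μ =
      ∫ c, (∑ v ∈ E.visited c, ∫ x, ψ v x ^ 2 ∂μ v) ∂Measure.pi μ := by
  classical
  have hdiag := E.integral_sum_visited (μ := μ) (φ := fun v x => ψ v x ^ 2)
    (fun v => (hψ v).pow_const 2) (fun v x => by
      rw [abs_pow]; exact pow_le_one₀ (abs_nonneg _) (hb v x)) ∅
  simp only [Finset.sdiff_empty] at hdiag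
  rw [← hdiag]
  -- the two ordered parts of the cross term of `v` and `w`
  let f : V → V → (V → ℝ≥0) → ℝ := fun v w c =>
    ({c | E.before c v w}.indicator 1 c * ψ v (c v)) * ψ w (c w)
  have hfm : ∀ v w, Measurable fun c : V → ℝ≥0 =>
      {c | E.before c v w}.indicator (1 : (V → ℝ≥0) → ℝ) c * ψ v (c v) := fun v w =>
    (measurable_one.indicator (E.measurableSet_before v w)).mul
      ((hψ v).comp (measurable_pi_apply v))
  have hf0 : ∀ v w, v ≠ w → ∫ c, f v w c ∂Measure.pi μ = 0 := by
    intro v w hvw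
    rw [integral_mul_comp_eval μ (hfm v w) _ (hψ w), h0, mul_zero]
    intro c x
    simp only [Set.indicator_apply, Set.mem_ofPred_eq, Pi.one_apply, E.before_update c v w x hvw,
      update_of_ne hvw]
  have hfi : ∀ v w, Integrable (f v w) (Measure.pi μ) := by
    intro v w
    refine integrable_of_bounded (K := 1) ((hfm v w).mul ((hψ w).comp (measurable_pi_apply w)))
      fun c => ?_
    have : |ψ v (c v) * ψ w (c w)| ≤ 1 := by
      rw [abs_mul]; exact mul_le_one₀ (hb _ _) (abs_nonneg _) (hb _ _)
    by_cases h : E.before c v w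
    · simpa [f, h, abs_mul] using this
    · simp [f, h]
  have hexp : ∀ c : V → ℝ≥0, (∑ v ∈ E.visited c, ψ v (c v)) ^ 2 =
      (∑ v ∈ E.visited c, ψ v (c v) ^ 2) +
        ∑ p ∈ (Finset.univ : Finset V).offDiag, (f p.1 p.2 c + f p.2 p.1 c) := by
    intro c
    rw [sq, Finset.sum_mul_sum, ← Finset.sum_product', ← Finset.diag_union_offDiag,
      Finset.sum_union (Finset.disjoint_diag_offDiag _), Finset.sum_diag]
    congr 1
    · exact Finset.sum_congr rfl fun v _ => (sq _).symm
    · symm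
      rw [← Finset.sum_subset (s₁ := (E.visited c).offDiag)]
      · refine Finset.sum_congr rfl fun p hp => ?_
        obtain ⟨h1, h2, h3⟩ := Finset.mem_offDiag.1 hp
        rcases (E.visited_iff c p.1 p.2 h3).1 ⟨h1, h2⟩ with h | h
        · have h' := E.not_before c p.1 p.2 h3 h
          simp [f, h, h']
        · have h' := E.not_before c p.2 p.1 h3.symm h
          simp [f, h, h', mul_comm]
      · intro p hp; simpa using (Finset.mem_offDiag.1 hp).2.2
      · intro p hp hp'
        have h3 : p.1 ≠ p.2 := (Finset.mem_offDiag.1 hp).2.2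
        have : ¬ (p.1 ∈ E.visited c ∧ p.2 ∈ E.visited c) := fun h =>
          hp' (Finset.mem_offDiag.2 ⟨h.1, h.2, h3⟩)
        rw [E.visited_iff c p.1 p.2 h3, not_or] at this
        simp [f, this.1, this.2]
  have hvi : Integrable (fun c => ∑ v ∈ E.visited c, ψ v (c v) ^ 2) (Measure.pi μ) := by
    have hm := E.measurable_sum_visited (φ := fun v x => ψ v x ^ 2)
      (fun v => (hψ v).pow_const 2) ∅
    have hb' := E.abs_sum_visited_le (φ := fun v x => ψ v x ^ 2) (fun v x => by
      rw [abs_pow]; exact pow_le_one₀ (abs_nonneg _) (hb v x)) ∅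
    simp only [Finset.sdiff_empty] at hm hb'
    exact integrable_of_bounded hm hb'
  have hpi : ∀ p : V × V, Integrable (fun c => f p.1 p.2 c + f p.2 p.1 c) (Measure.pi μ) :=
    fun p => (hfi _ _).add (hfi _ _)
  rw [integral_congr_ae (.of_forall hexp), integral_add hvi
    (integrable_finsetSum _ fun p _ => hpi p), integral_finsetSum _ fun p _ => hpi p]
  rw [Finset.sum_eq_zero, add_zero]
  intro p hp
  have h3 : p.1 ≠ p.2 := (Finset.mem_offDiag.1 hp).2.2
  rw [integral_add (hfi _ _) (hfi _ _), hf0 _ _ h3, hf0 _ _ h3.symm, add_zero]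

/-- Chebyshev's inequality for the martingale of an exploration: on any event that is not too
unlikely, the inspected values sometimes sum up to little more than their means. -/
theorem exists_sum_visited_le {φ : V → ℝ≥0 → ℝ} (hφ : ∀ v, Measurable (φ v))
    (hI : ∀ v x, φ v x ∈ Set.Icc (0 : ℝ) 1) {q b : ℝ} (hq0 : 0 ≤ q) (hb0 : 0 ≤ b)
    (hb : 4 * (q + 1) ≤ b ^ 2) (hq : ∀ c, sumVar μ φ (E.visited c) ≤ q) {G : Set (V → ℝ≥0)}
    (hG : 1 / 4 < (Measure.pi μ).real G) :
    ∃ c ∈ G, ∑ v ∈ E.visited c, φ v (c v) ≤ sumMean μ φ (E.visited c) + b := by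
  set ψ : V → ℝ≥0 → ℝ := fun v x => φ v x - ∫ y, φ v y ∂μ v with hψ
  have hψm : ∀ v, Measurable (ψ v) := fun v => (hφ v).sub_const _
  have hψb : ∀ v x, |ψ v x| ≤ 1 := fun v x => abs_centered_le (hφ v) (hI v) x
  set D : (V → ℝ≥0) → ℝ := fun c => ∑ v ∈ E.visited c, ψ v (c v) with hD
  have hDm : Measurable D := by
    have := E.measurable_sum_visited hψm ∅
    simpa only [Finset.sdiff_empty] using this
  have hDb : ∀ c, |D c| ≤ Fintype.card V := by
    have := E.abs_sum_visited_le hψb ∅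
    simpa only [Finset.sdiff_empty] using this
  have hD2i : Integrable (fun c => D c ^ 2) (Measure.pi μ) :=
    integrable_of_bounded (K := (Fintype.card V : ℝ) ^ 2) (hDm.pow_const 2) fun c => by
      rw [abs_pow]; exact pow_le_pow_left₀ (abs_nonneg _) (hDb c) 2
  have hD2 : ∫ c, D c ^ 2 ∂Measure.pi μ ≤ q := by
    rw [hD, E.integral_sum_visited_sq hψm hψb fun v => integral_centered (hφ v) (hI v)]
    have : ∫ c, sumVar μ φ (E.visited c) ∂Measure.pi μ ≤ ∫ _, q ∂Measure.pi μ :=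
      integral_mono_of_nonneg (.of_forall fun c => sumVar_nonneg _) (integrable_const _)
        (.of_forall hq)
    rw [integral_const, probReal_univ, one_smul] at this
    exact this
  obtain ⟨c, hcG, hcD⟩ : ∃ c ∈ G, ¬ 4 * (q + 1) ≤ D c ^ 2 := by
    by_contra! hcon
    have h1 := measureReal_mono (μ := Measure.pi μ) (s₁ := G)
      (s₂ := {c | 4 * (q + 1) ≤ D c ^ 2}) hcon
    have h2 := (mul_meas_ge_le_integral_of_nonneg (.of_forall fun c => sq_nonneg (D c)) hD2i
      (4 * (q + 1))).trans hD2
    nlinarith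
  refine ⟨c, hcG, ?_⟩
  have h1 : ∑ v ∈ E.visited c, φ v (c v) = sumMean μ φ (E.visited c) + D c := by
    simp [hD, hψ, sumMean]
  rw [h1]
  have h2 : D c ≤ b := (le_abs_self _).trans (abs_le_of_sq_le_sq (by linarith) hb0)
  linarith

end Exploration

/-! ### Truncated rewards at a threshold -/

/-- Some `r` vertices of `W` have total cost at most `x`. -/
def Cheap {V : Type*} (W : Finset V) (r : ℕ) (x : ℝ≥0) (c : V → ℝ≥0) : Prop :=
  ∃ S ⊆ W, S.card = r ∧ ∑ v ∈ S, c v ≤ x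

theorem measurableSet_sum_le {V : Type*} (S : Finset V) (x : ℝ≥0) :
    MeasurableSet {c : V → ℝ≥0 | ∑ v ∈ S, c v ≤ x} :=
  measurableSet_le (Finset.measurable_sum _ fun v _ => measurable_pi_apply v) measurable_const

theorem Exploration.measurableSet_cheap_visited {V : Type*} [Fintype V] [DecidableEq V]
    (E : Exploration V) (r : ℕ) (x : ℝ≥0) :
    MeasurableSet {c | Cheap (E.visited c) r x c} := by
  have : {c | Cheap (E.visited c) r x c} = ⋃ S : Finset V,
      {c | S ⊆ E.visited c} ∩ ({_c | S.card = r} ∩ {c | ∑ v ∈ S, c v ≤ x}) := by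
    ext c; simp [Cheap]
  rw [this]
  refine .iUnion fun S => .inter ?_ (.inter (.const _) (measurableSet_sum_le S x))
  have : {c | S ⊆ E.visited c} = ⋂ v ∈ S, {c | v ∈ E.visited c} := by
    ext c; simp [Finset.subset_iff]
  rw [this]
  exact .biInter S.countable_toSet fun v _ => E.measurableSet_visited v

theorem measurableSet_cheap {V : Type*} [Fintype V] (W : Finset V) (r : ℕ) (x : ℝ≥0) :
    MeasurableSet {c | Cheap W r x c} := by
  have : {c | Cheap W r x c} = ⋃ S : Finset V,
      ({_c | S ⊆ W ∧ S.card = r} ∩ {c | ∑ v ∈ S, c v ≤ x}) := by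
    ext c; simp [Cheap, and_assoc]
  rw [this]
  exact .iUnion fun S => .inter (.const _) (measurableSet_sum_le S x)

section Truncation

/-- The truncated reward of a vertex of cost `x` at the threshold `t`. -/
noncomputable def reward (t : ℝ) (x : ℝ≥0) : ℝ := max 0 (1 - x / t)

/-- The indicator of a cost of at most `t`. -/
noncomputable def affordable (t : ℝ) (x : ℝ≥0) : ℝ := if (x : ℝ) ≤ t then 1 else 0

variable {t : ℝ}

theorem measurable_reward : Measurable (reward t) := by
  unfold reward; fun_prop

theorem measurable_affordable : Measurable (affordable t) :=
  Measurable.ite (measurableSet_le measurable_coe_nnreal_real measurable_const) measurable_const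
    measurable_const

theorem affordable_mem_Icc (x : ℝ≥0) : affordable t x ∈ Set.Icc (0 : ℝ) 1 := by
  unfold affordable; split_ifs <;> simp

theorem reward_mem_Icc (ht : 0 < t) (x : ℝ≥0) : reward t x ∈ Set.Icc (0 : ℝ) 1 :=
  ⟨le_max_left _ _, max_le zero_le_one (sub_le_self _ (by positivity))⟩

/-- The part of the cost that `reward` does not see is the cost itself, up to the threshold. -/
theorem mul_affordable_sub_reward (ht : 0 < t) (x : ℝ≥0) :
    t * (affordable t x - reward t x) = if (x : ℝ) ≤ t then (x : ℝ) else 0 := by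
  unfold affordable reward
  split_ifs with h
  · have h1 : (x : ℝ) / t ≤ 1 := (div_le_one ht).2 h
    rw [max_eq_right (by linarith)]; field_simp; ring
  · have h1 : 1 < (x : ℝ) / t := (one_lt_div ht).2 (not_le.1 h)
    rw [max_eq_left (by linarith)]; simp

theorem reward_le_affordable (ht : 0 < t) (x : ℝ≥0) : reward t x ≤ affordable t x := by
  have h := mul_affordable_sub_reward ht x
  have : 0 ≤ t * (affordable t x - reward t x) := by rw [h]; split_ifs <;> simp
  nlinarith [nonneg_of_mul_nonneg_right this ht]

theorem sum_reward_ge {V : Type*} (ht : 0 < t) {S : Finset V} {c : V → ℝ≥0} {x : ℝ≥0}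
    (h : ∑ v ∈ S, c v ≤ x) : S.card - x / t ≤ ∑ v ∈ S, reward t (c v) := by
  have h1 : (∑ v ∈ S, (c v : ℝ)) ≤ x := by exact_mod_cast h
  calc (S.card : ℝ) - x / t ≤ S.card - (∑ v ∈ S, (c v : ℝ)) / t := by gcongr
    _ = ∑ v ∈ S, (1 - (c v : ℝ) / t) := by simp [Finset.sum_div]
    _ ≤ _ := Finset.sum_le_sum fun v _ => le_max_right _ _

end Truncation

section Dichotomy

variable {V : Type*} [Fintype V] [DecidableEq V] (E : Exploration V) {μ : V → Measure ℝ≥0}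
  [∀ v, IsProbabilityMeasure (μ v)]

/-- If an exploration with values in the family `𝒯` finds `r` vertices of total cost at most `B`
with probability close to `1`, then, for each threshold `t`, boundedly many fixed members of `𝒯`
have a union `W` that either contains `r` vertices of cost at most `t` with constant probability,
or contains `r ± O(B / t)` of those on average, their expected total cost being `O(B)`. -/
theorem exists_union_affordable_or_concentrated {𝒯 : Finset (Finset V)}
    (hE : ∀ c, E.visited c ∈ 𝒯) {r : ℕ} {B : ℝ≥0} (hB : 0 < B)
    (hG : 511 / 512 ≤ (Measure.pi μ).real {c | Cheap (E.visited c) r B c})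
    {t : ℝ} (ht : 0 < t) (ha : 1 / 2 ≤ B / t) :
    ∃ F ⊆ 𝒯, F.card ≤ 12290 ∧
      (1 / 512 ≤ (Measure.pi μ).real
          {c | (r : ℝ) ≤ ∑ v ∈ F.biUnion id, affordable t (c v)} ∨
        ((∫ c, ∑ v ∈ F.biUnion id, (affordable t (c v) - reward t (c v)) ∂Measure.pi μ) ≤
            36 * (B / t) ∧
          (∫ c, |∑ v ∈ F.biUnion id, affordable t (c v) - r| ∂Measure.pi μ) ≤ 18 * (B / t) ∧
          t ≠ 2 * B)) := by
  set w : V → ℝ := fun v => ∫ x, reward t x ∂μ v with hw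
  have hwI : ∀ v, w v ∈ Set.Icc (0 : ℝ) 1 := fun v =>
    mean_mem_Icc (φ := fun _ => reward t) (v := v) measurable_reward (reward_mem_Icc ht)
  obtain ⟨T₁, hT₁, hmax, F, hF, hcard, hsub, hcov⟩ :=
    exists_greedy_cover 𝒯 ⟨_, hE 0⟩ (fun v => (hwI v).1) 12288
  refine ⟨F, hF, hcard, ?_⟩
  set W := F.biUnion id with hW
  set ν := Measure.pi μ with hν
  set a : ℝ := B / t with had
  set g : ℝ := ∑ v ∈ W, w v - ∑ v ∈ T₁, w v with hg
  have hg0 : 0 ≤ g := sub_nonneg.2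
    (Finset.sum_le_sum_of_subset_of_nonneg hsub fun v _ _ => (hwI v).1)
  by_cases hs : 1 / 512 ≤ ν.real {c | (r : ℝ) ≤ ∑ v ∈ W, affordable t (c v)}
  · exact .inl hs
  refine .inr ?_
  rw [not_le] at hs
  have hφm : ∀ v : V, Measurable ((fun _ => reward t) v : ℝ≥0 → ℝ) := fun _ => measurable_reward
  have hφI : ∀ (v : V) x, (fun _ => reward t) v x ∈ Set.Icc (0 : ℝ) 1 := fun _ => reward_mem_Icc ht
  have hιm : ∀ v : V, Measurable ((fun _ => affordable t) v : ℝ≥0 → ℝ) :=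
    fun _ => measurable_affordable
  have hιI : ∀ (v : V) x, (fun _ => affordable t) v x ∈ Set.Icc (0 : ℝ) 1 :=
    fun _ => affordable_mem_Icc
  have hφb : ∀ (v : V) x, |(fun _ => reward t) v x| ≤ 1 := fun v x => by
    rw [abs_of_nonneg (hφI v x).1]; exact (hφI v x).2
  have hιb : ∀ (v : V) x, |(fun _ => affordable t) v x| ≤ 1 := fun v x => by
    rw [abs_of_nonneg (hιI v x).1]; exact (hιI v x).2
  set G : Set (V → ℝ≥0) := {c | Cheap (E.visited c) r B c} with hGd
  have hGm : MeasurableSet G := E.measurableSet_cheap_visited r B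
  have hGc : ν.real Gᶜ ≤ 1 / 512 := by rw [probReal_compl_eq_one_sub hGm]; linarith
  -- the reward that the exploration collects outside `W`
  set Zo : (V → ℝ≥0) → ℝ := fun c => ∑ v ∈ E.visited c \ W, reward t (c v) with hZo
  have hZom : Measurable Zo := E.measurable_sum_visited hφm W
  have hZoi : Integrable Zo ν := integrable_of_bounded hZom (E.abs_sum_visited_le hφb W)
  have hZo0 : ∀ c, 0 ≤ Zo c := fun c => Finset.sum_nonneg fun v _ => (hφI v _).1
  have hZoE : ∫ c, Zo c ∂ν ≤ g / 12288 := by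
    rw [hZo, E.integral_sum_visited hφm hφb W]
    have : ∫ c, (∑ v ∈ E.visited c \ W, ∫ x, reward t x ∂μ v) ∂ν ≤ ∫ _, g / 12288 ∂ν := by
      refine integral_mono_of_nonneg (.of_forall fun c => Finset.sum_nonneg fun v _ => (hwI v).1)
        (integrable_const _) (.of_forall fun c => ?_)
      have := (hcov _ (hE c)).2
      push_cast at this
      show ∑ v ∈ E.visited c \ W, w v ≤ g / 12288
      linarith
    simpa using this
  have hZoP : ∀ y : ℝ, 0 < y → ν.real {c | y ≤ Zo c} ≤ g / 12288 / y := by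
    intro y hy
    rw [le_div_iff₀ hy, mul_comm]
    exact (mul_meas_ge_le_integral_of_nonneg (.of_forall hZo0) hZoi y).trans hZoE
  have hsplit : ∀ c, ∑ v ∈ E.visited c, reward t (c v) ≤ ∑ v ∈ W, reward t (c v) + Zo c := by
    intro c
    rw [← Finset.sum_inter_add_sum_sdiff (E.visited c) W]
    exact add_le_add_left (Finset.sum_le_sum_of_subset_of_nonneg Finset.inter_subset_right
      fun v _ _ => (hφI v _).1) _
  have hGr : ∀ c ∈ G, r - a ≤ ∑ v ∈ E.visited c, reward t (c v) := by
    rintro c ⟨S, hS, hSr, hSB⟩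
    have h1 := sum_reward_ge ht hSB
    rw [hSr] at h1
    exact h1.trans (Finset.sum_le_sum_of_subset_of_nonneg hS fun v _ _ => (hφI v _).1)
  have hSN : ∀ c : V → ℝ≥0, ∑ v ∈ W, reward t (c v) ≤ ∑ v ∈ W, affordable t (c v) := fun c =>
    Finset.sum_le_sum fun v _ => reward_le_affordable ht _
  set ℓ : ℝ := a + 1 + g / 24 with hℓ
  have hℓ0 : 0 ≤ ℓ := by positivity
  -- outside a small event, both sums over `W` are within `ℓ` of `r`
  have hconc : ∀ Q : Set (V → ℝ≥0), MeasurableSet Q →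
      (∀ c ∈ G, Zo c < 1 + g / 24 → ¬ (r : ℝ) ≤ ∑ v ∈ W, affordable t (c v) → c ∈ Q) →
      127 / 128 < ν.real Q := by
    intro Q hQm hQ
    have hsubset : Qᶜ ⊆ Gᶜ ∪ ({c | 1 + g / 24 ≤ Zo c} ∪
        {c | (r : ℝ) ≤ ∑ v ∈ W, affordable t (c v)}) := by
      intro c hc
      by_contra hcon
      simp only [Set.mem_union, Set.mem_compl_iff, Set.mem_ofPred_eq, not_or, not_not] at hcon
      exact hc (hQ c hcon.1 (not_le.1 hcon.2.1) hcon.2.2)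
    have h1 : ν.real {c | 1 + g / 24 ≤ Zo c} ≤ 1 / 512 := by
      refine (hZoP _ (by positivity)).trans ?_
      rw [div_le_iff₀ (by positivity)]; linarith
    have h2 := (measureReal_mono (μ := ν) hsubset).trans ((measureReal_union_le _ _).trans
      (add_le_add_right (measureReal_union_le _ _) _))
    rw [probReal_compl_eq_one_sub hQm] at h2
    linarith
  have hSm := measurable_sum_comp_eval hφm W
  have hNm := measurable_sum_comp_eval hιm W
  have acS := sumVar_add_sq_le_of_concentrated (μ := μ) hφm hφI W r ℓ
    (hconc _ (measurableSet_le (hSm.sub_const _).abs measurable_const) fun c hc hZ hN => by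
      have h1 := hGr c hc
      have h2 := hsplit c
      have h3 := hSN c
      rw [Set.mem_ofPred_eq, abs_le]
      constructor <;> linarith)
  have acN := sumVar_add_sq_le_of_concentrated (μ := μ) hιm hιI W r ℓ
    (hconc _ (measurableSet_le (hNm.sub_const _).abs measurable_const) fun c hc hZ hN => by
      have h1 := hGr c hc
      have h2 := hsplit c
      have h3 := hSN c
      rw [Set.mem_ofPred_eq, abs_le]
      constructor <;> linarith)
  have hVS := sumVar_nonneg (μ := μ) (φ := fun _ => reward t) W
  have hVN := sumVar_nonneg (μ := μ) (φ := fun _ => affordable t) W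
  have hμS : sumMean μ (fun _ => reward t) W = ∑ v ∈ W, w v := rfl
  have hbS : |sumMean μ (fun _ => reward t) W - r| ≤ 1 + 2 * ℓ :=
    abs_le_of_sq_le_sq (by nlinarith) (by positivity)
  have hbN : |sumMean μ (fun _ => affordable t) W - r| ≤ 1 + 2 * ℓ :=
    abs_le_of_sq_le_sq (by nlinarith) (by positivity)
  rw [abs_le] at hbS hbN
  -- Chebyshev for the exploration: the weight of `T₁` is not much below `r`
  have hT : r - a ≤ ∑ v ∈ T₁, w v + (12 + 4 * ℓ + g / 8) := by
    have hq : ∀ c, sumVar μ (fun _ => reward t) (E.visited c) ≤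
        sumVar μ (fun _ => reward t) W + g := by
      intro c
      rw [sumVar, ← Finset.sum_inter_add_sum_sdiff (E.visited c) T₁]
      refine add_le_add ?_ ?_
      · exact Finset.sum_le_sum_of_subset_of_nonneg (Finset.inter_subset_right.trans hsub)
          fun v _ _ => integral_nonneg fun x => sq_nonneg _
      · refine le_trans (Finset.sum_le_sum fun v _ => ?_) (hcov _ (hE c)).1
        exact variance_le_mean (μ := μ) (φ := fun _ => reward t) measurable_reward
          (reward_mem_Icc ht)
    have hsq : 4 * (sumVar μ (fun _ => reward t) W + g + 1) ≤ (12 + 4 * ℓ + g / 8) ^ 2 := by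
      have h1 : sumVar μ (fun _ => reward t) W ≤ 1 + 2 * ℓ ^ 2 :=
        le_trans (le_add_of_nonneg_right (sq_nonneg _)) acS
      have h2 : g ≤ (g / 16 + 4) ^ 2 := by linarith [sq_nonneg (g / 16 - 4)]
      have h3 : (12 + 4 * ℓ + g / 8) ^ 2 = (4 * ℓ) ^ 2 + 16 + 4 * (g / 16 + 4) ^ 2 +
          2 * (4 * ℓ) * 4 + 2 * (4 * ℓ + 4) * (2 * (g / 16 + 4)) := by ring
      have h4 : 0 ≤ 2 * (4 * ℓ) * 4 + 2 * (4 * ℓ + 4) * (2 * (g / 16 + 4)) := by positivity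
      rw [h3]
      linarith [sq_nonneg ℓ]
    obtain ⟨c, hcG, hc⟩ := E.exists_sum_visited_le (μ := μ) hφm hφI
      (add_nonneg hVS hg0) (by positivity) hsq hq (by linarith : 1 / 4 < ν.real G)
    have h1 : sumMean μ (fun _ => reward t) (E.visited c) ≤ ∑ v ∈ T₁, w v := hmax _ (hE c)
    linarith [hGr c hcG]
  have hgle : g ≤ 31 + 12 * a := by
    rw [hμS] at hbS
    linarith [hbS.2]
  have hℓle : 1 + 2 * ℓ ≤ 3 * a + 6 := by linarith
  have hSi : Integrable (fun c : V → ℝ≥0 => ∑ v ∈ W, reward t (c v)) ν :=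
    integrable_of_bounded hSm (abs_sum_comp_eval_le hφb W)
  have hNi : Integrable (fun c : V → ℝ≥0 => ∑ v ∈ W, affordable t (c v)) ν :=
    integrable_of_bounded hNm (abs_sum_comp_eval_le hιb W)
  refine ⟨?_, ?_, ?_⟩
  · simp only [Finset.sum_sub_distrib]
    have e1 := integral_sum_comp_eval (μ := μ) hιm hιI W
    have e2 := integral_sum_comp_eval (μ := μ) hφm hφI W
    rw [integral_sub hNi hSi, e1, e2]
    linarith [hbS.1, hbN.2]
  · refine (integral_abs_sum_sub_le (μ := μ) hιm hιI W (κ := 1 + 2 * ℓ) (by positivity)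
      (by nlinarith)).trans (by linarith)
  · -- at the threshold `2 B` a selected vertex has reward at least `1 / 2`
    intro h2B
    have ha2 : a = 1 / 2 := by
      rw [had, h2B]; field_simp
    have h1 : ν.real {c | 1 / 2 ≤ Zo c} ≤ 1 / 128 := by
      refine (hZoP _ (by norm_num)).trans ?_
      rw [ha2] at hgle
      linarith
    have hsubset : G ⊆ {c | 1 / 2 ≤ Zo c} ∪ {c | (r : ℝ) ≤ ∑ v ∈ W, affordable t (c v)} := by
      rintro c ⟨S, hS, hSr, hSB⟩
      have hcv : ∀ v ∈ S, (c v : ℝ) ≤ B := fun v hv => by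
        exact_mod_cast (Finset.single_le_sum (fun _ _ => zero_le) hv).trans hSB
      by_cases hSW : S ⊆ W
      · right
        have h3 : ∀ v ∈ S, affordable t (c v) = 1 := fun v hv => by
          rw [affordable, if_pos]
          have := hcv v hv
          have hB' : (0 : ℝ) ≤ B := B.2
          linarith
        have h4 : ∑ v ∈ S, affordable t (c v) ≤ ∑ v ∈ W, affordable t (c v) :=
          Finset.sum_le_sum_of_subset_of_nonneg hSW fun v _ _ => (hιI v _).1
        rw [Finset.sum_congr rfl h3] at h4
        simpa [hSr] using h4
      · left
        obtain ⟨v, hvS, hvW⟩ := Finset.not_subset.1 hSW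
        have h3 : reward t (c v) ≤ Zo c :=
          Finset.single_le_sum (f := fun v => reward t (c v)) (fun v _ => (hφI v _).1)
            (Finset.mem_sdiff.2 ⟨hS hvS, hvW⟩)
        have h4 : (c v : ℝ) / t ≤ 1 / 2 := by
          rw [div_le_iff₀ ht]; linarith [hcv v hvS]
        have h5 : 1 - (c v : ℝ) / t ≤ reward t (c v) := le_max_right _ _
        show 1 / 2 ≤ Zo c
        linarith
    have h2 := (measureReal_mono (μ := ν) hsubset).trans (measureReal_union_le _ _)
    linarith

end Dichotomy

/-! ### The critical threshold -/

section Union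

variable {V : Type*}

theorem sum_affordable (W : Finset V) (t : ℝ) (c : V → ℝ≥0) :
    ∑ v ∈ W, affordable t (c v) = ({v ∈ W | (c v : ℝ) ≤ t}.card : ℝ) := by
  simp [affordable]

variable [DecidableEq V]

/-- Take the vertices of cost at most `t` of one set, and fill up with vertices of cost at most
`2 t` of another one. -/
theorem exists_subset_sum_le {W₁ W₂ : Finset V} {r : ℕ} {t : ℝ} (ht : 0 < t) {c : V → ℝ≥0}
    (h : (r : ℝ) ≤ ∑ v ∈ W₂, affordable (2 * t) (c v)) :
    ∃ S ⊆ W₁ ∪ W₂, S.card = r ∧ ∑ v ∈ S, (c v : ℝ) ≤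
      t * ∑ v ∈ W₁, (affordable t (c v) - reward t (c v)) +
        2 * t * |∑ v ∈ W₁, affordable t (c v) - r| := by
  rw [Finset.mul_sum, Finset.sum_congr rfl fun v _ => mul_affordable_sub_reward ht (c v),
    ← Finset.sum_filter, sum_affordable]
  rw [sum_affordable] at h
  set A := {v ∈ W₁ | (c v : ℝ) ≤ t} with hA
  set D := {v ∈ W₂ | (c v : ℝ) ≤ 2 * t} with hD
  have hD' : r ≤ D.card := by exact_mod_cast h
  have hAW : A ⊆ W₁ ∪ W₂ := (Finset.filter_subset _ _).trans Finset.subset_union_left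
  have hDW : D ⊆ W₁ ∪ W₂ := (Finset.filter_subset _ _).trans Finset.subset_union_right
  rcases le_total r A.card with hr | hr
  · obtain ⟨S, hSA, hS⟩ := Finset.exists_subset_card_eq hr
    refine ⟨S, hSA.trans hAW, hS, ?_⟩
    have h1 : ∑ v ∈ S, (c v : ℝ) ≤ ∑ v ∈ A, (c v : ℝ) :=
      Finset.sum_le_sum_of_subset_of_nonneg hSA fun v _ _ => (c v).2
    have h2 : 0 ≤ 2 * t * |(A.card : ℝ) - r| := by positivity
    linarith
  · obtain ⟨S, hAS, hSD, hS⟩ := Finset.exists_subsuperset_card_eq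
      (Finset.subset_union_left : A ⊆ A ∪ D) hr
      (hD'.trans (Finset.card_le_card Finset.subset_union_right))
    refine ⟨S, hSD.trans (Finset.union_subset hAW hDW), hS, ?_⟩
    rw [← Finset.sum_sdiff hAS, add_comm]
    have h1 : ∑ v ∈ S \ A, (c v : ℝ) ≤ ∑ v ∈ S \ A, 2 * t := Finset.sum_le_sum fun v hv => by
      obtain ⟨hv1, hv2⟩ := Finset.mem_sdiff.1 hv
      have := (Finset.mem_union.1 (hSD hv1)).resolve_left hv2
      exact (Finset.mem_filter.1 this).2
    have h2 : ((S \ A).card : ℝ) = r - A.card := by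
      rw [Finset.card_sdiff_of_subset hAS, hS, Nat.cast_sub hr]
    rw [Finset.sum_const, nsmul_eq_mul, h2] at h1
    have h3 : (r : ℝ) - A.card ≤ |(A.card : ℝ) - r| := by
      rw [abs_sub_comm]; exact le_abs_self _
    have : (r - A.card) * (2 * t) ≤ 2 * t * |(A.card : ℝ) - r| := by
      rw [mul_comm]; gcongr
    linarith

variable [Fintype V] (E : Exploration V) {μ : V → Measure ℝ≥0} [∀ v, IsProbabilityMeasure (μ v)]

/-- If an exploration with values in the family `𝒯` finds `r` vertices of total cost at most `B`
with probability close to `1`, then, with constant probability, the union of boundedly many fixed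
members of `𝒯` contains `r` vertices of total cost `O(B)`. The threshold at which the members are
chosen is the critical one, at which the first alternative of
`exists_union_affordable_or_concentrated` begins to fail. -/
theorem exists_union_cheap {𝒯 : Finset (Finset V)} (hE : ∀ c, E.visited c ∈ 𝒯) {r : ℕ} {B : ℝ≥0}
    (hB : 0 < B)
    (hG : 511 / 512 ≤ (Measure.pi μ).real {c | Cheap (E.visited c) r B c}) :
    ∃ F ⊆ 𝒯, F.card ≤ 24580 ∧
      1 / 1024 ≤ (Measure.pi μ).real {c | Cheap (F.biUnion id) r (73728 * B) c} := by
  set ν := Measure.pi μ with hν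
  have hB' : (0 : ℝ) < B := hB
  let t : ℕ → ℝ := fun l => 2 * B / 2 ^ l
  have ht : ∀ l, 0 < t l := fun l => by positivity
  have hat : ∀ l, B / t l = 2 ^ l / 2 := fun l => by simp only [t]; field_simp
  have ha : ∀ l, 1 / 2 ≤ B / t l := fun l => by
    rw [hat]; linarith [one_le_pow₀ (one_le_two : (1 : ℝ) ≤ 2) (n := l)]
  choose F hF hcard hdich using fun l =>
    exists_union_affordable_or_concentrated E hE hB hG (ht l) (ha l)
  by_cases hall : ∀ l, 1 / 512 ≤ ν.real
      {c | (r : ℝ) ≤ ∑ v ∈ (F l).biUnion id, affordable (t l) (c v)}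
  · refine ⟨F r, hF r, (hcard r).trans (by norm_num), le_trans ?_ ((hall r).trans
      (measureReal_mono fun c hc => ?_))⟩
    · norm_num
    · have hc' : (r : ℝ) ≤ ∑ v ∈ (F r).biUnion id, affordable (t r) (c v) := hc
      rw [sum_affordable] at hc'
      obtain ⟨S, hSA, hS⟩ := Finset.exists_subset_card_eq (Nat.cast_le.1 hc')
      refine ⟨S, hSA.trans (Finset.filter_subset _ _), hS, ?_⟩
      have h1 : ∑ v ∈ S, (c v : ℝ) ≤ ∑ v ∈ S, t r :=
        Finset.sum_le_sum fun v hv => (Finset.mem_filter.1 (hSA hv)).2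
      rw [Finset.sum_const, hS, nsmul_eq_mul] at h1
      have h2 : (r : ℝ) * t r ≤ 2 * B := by
        simp only [t]
        rw [← mul_div_assoc, div_le_iff₀ (by positivity)]
        have : (r : ℝ) ≤ 2 ^ r := by exact_mod_cast Nat.lt_two_pow_self.le
        nlinarith
      have h3 : ((∑ v ∈ S, c v : ℝ≥0) : ℝ) ≤ ((73728 * B : ℝ≥0) : ℝ) := by
        push_cast; linarith
      exact_mod_cast h3
  · -- the largest threshold `t` of the form `2 B / 2 ^ (l + 1)` at which few vertices are found
    obtain ⟨l, hl, hl'⟩ : ∃ l, (1 / 512 ≤ ν.real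
        {c | (r : ℝ) ≤ ∑ v ∈ (F l).biUnion id, affordable (t l) (c v)}) ∧ ¬ (1 / 512 ≤ ν.real
        {c | (r : ℝ) ≤ ∑ v ∈ (F (l + 1)).biUnion id, affordable (t (l + 1)) (c v)}) := by
      by_contra! hcon
      refine hall fun l => ?_
      induction l with
      | zero =>
        rcases hdich 0 with h | h
        · exact h
        · exact absurd (by simp [t]) h.2.2
      | succ l ih => exact hcon l ih
    obtain ⟨h1, h2, -⟩ := (hdich (l + 1)).resolve_left hl'
    have htt : t l = 2 * t (l + 1) := by simp only [t, pow_succ]; field_simp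
    set W₁ := (F (l + 1)).biUnion id with hW₁
    set W₂ := (F l).biUnion id with hW₂
    have hat1 : t (l + 1) * (B / t (l + 1)) = B := by
      have := (ht (l + 1)).ne'
      field_simp
    rw [htt] at hl
    have ht' := ht (l + 1)
    generalize t (l + 1) = t₁ at *
    set U : (V → ℝ≥0) → ℝ := fun c => t₁ * ∑ v ∈ W₁, (affordable t₁ (c v) - reward t₁ (c v)) +
        2 * t₁ * |∑ v ∈ W₁, affordable t₁ (c v) - r| with hU
    have m1 : Measurable fun c : V → ℝ≥0 => ∑ v ∈ W₁, (affordable t₁ (c v) - reward t₁ (c v)) :=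
      measurable_sum_comp_eval (ψ := fun _ x => affordable t₁ x - reward t₁ x)
        (fun _ => measurable_affordable.sub measurable_reward) W₁
    have i1 : Integrable
        (fun c : V → ℝ≥0 => ∑ v ∈ W₁, (affordable t₁ (c v) - reward t₁ (c v))) ν :=
      integrable_of_bounded m1
        (abs_sum_comp_eval_le (ψ := fun _ x => affordable t₁ x - reward t₁ x) (fun _ x => by
          have := affordable_mem_Icc (t := t₁) x
          have := reward_mem_Icc ht' x
          rw [abs_le]; constructor <;> linarith [this.1, this.2, (affordable_mem_Icc (t := t₁) x).1,
            (affordable_mem_Icc (t := t₁) x).2]) W₁)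
    have i2 : Integrable (fun c : V → ℝ≥0 => |∑ v ∈ W₁, affordable t₁ (c v) - r|) ν :=
      ((integrable_of_bounded (measurable_sum_comp_eval (ψ := fun _ => affordable t₁)
        (fun _ => measurable_affordable) W₁) (abs_sum_comp_eval_le (ψ := fun _ => affordable t₁)
        (fun _ x => by
          rw [abs_of_nonneg (affordable_mem_Icc x).1]; exact (affordable_mem_Icc x).2) W₁)).sub
        (integrable_const _)).abs
    have hUi : Integrable U ν := (i1.const_mul _).add (i2.const_mul _)
    have hU0 : ∀ c, 0 ≤ U c := fun c => add_nonneg (mul_nonneg ht'.le (Finset.sum_nonneg fun v _ =>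
      sub_nonneg.2 (reward_le_affordable ht' _))) (by positivity)
    have hUE : ∫ c, U c ∂ν ≤ 72 * B := by
      rw [hU, integral_add (i1.const_mul _) (i2.const_mul _), integral_const_mul,
        integral_const_mul]
      have h3 := mul_le_mul_of_nonneg_left h1 ht'.le
      have h4 := mul_le_mul_of_nonneg_left h2 (by positivity : 0 ≤ 2 * t₁)
      linarith
    have hUP : ν.real {c | 73728 * B ≤ U c} ≤ 1 / 1024 := by
      have h3 := (mul_meas_ge_le_integral_of_nonneg (.of_forall hU0) hUi (73728 * B)).trans hUE
      by_contra! hcon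
      nlinarith
    refine ⟨F (l + 1) ∪ F l, Finset.union_subset (hF _) (hF _),
      (Finset.card_union_le _ _).trans (by linarith [hcard l, hcard (l + 1)]), ?_⟩
    have hsubset : {c | (r : ℝ) ≤ ∑ v ∈ W₂, affordable (2 * t₁) (c v)} ⊆
        {c | Cheap ((F (l + 1) ∪ F l).biUnion id) r (73728 * B) c} ∪ {c | 73728 * B ≤ U c} := by
      intro c hc
      by_cases hcU : 73728 * B ≤ U c
      · exact .inr hcU
      · left
        obtain ⟨S, hS, hSr, hSc⟩ := exists_subset_sum_le (W₁ := W₁) ht' hc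
        refine ⟨S, by rwa [Finset.union_biUnion], hSr, ?_⟩
        have h3 : ((∑ v ∈ S, c v : ℝ≥0) : ℝ) ≤ ((73728 * B : ℝ≥0) : ℝ) := by
          push_cast; exact hSc.trans (not_le.1 hcU).le
        exact_mod_cast h3
    have h3 := hl.trans ((measureReal_mono (μ := ν) hsubset).trans (measureReal_union_le _ _))
    linarith

end Union

/-! ### Walks, and the exploration made by a policy -/

section Walks

variable {V : Type*} [PseudoMetricSpace V]

/-- All vertices of `W` lie on a walk of length at most `b` that starts at `root`. -/
def OnWalk (root : V) (W : Finset V) (b : ℝ≥0∞) : Prop :=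
  ∃ (n : ℕ) (f : ℕ → V), f 0 = root ∧ (∀ v ∈ W, ∃ s ≤ n, f s = v) ∧
    ∑ s ∈ Finset.range n, edist (f s) (f (s + 1)) ≤ b

/-- All vertices of `W` lie on a closed walk of length at most `b` that starts at `root`. -/
def OnLoop (root : V) (W : Finset V) (b : ℝ≥0∞) : Prop :=
  ∃ (n : ℕ) (f : ℕ → V), f 0 = root ∧ f n = root ∧ (∀ v ∈ W, ∃ s ≤ n, f s = v) ∧
    ∑ s ∈ Finset.range n, edist (f s) (f (s + 1)) ≤ b

variable {root : V} {W W' : Finset V} {b b' : ℝ≥0∞}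

theorem OnWalk.mono (h : OnWalk root W b) (hW : W' ⊆ W) : OnWalk root W' b :=
  let ⟨n, f, h0, hv, hb⟩ := h
  ⟨n, f, h0, fun v hv' => hv v (hW hv'), hb⟩

theorem OnLoop.mono (h : OnLoop root W b) (hW : W' ⊆ W) (hb : b ≤ b') : OnLoop root W' b' :=
  let ⟨n, f, h0, hn, hv, hb'⟩ := h
  ⟨n, f, h0, hn, fun v hv' => hv v (hW hv'), hb'.trans hb⟩

theorem onLoop_empty : OnLoop root ∅ b := ⟨0, fun _ => root, rfl, rfl, by simp, by simp⟩

theorem sum_edist_congr {f g : ℕ → V} {n : ℕ} (h : ∀ s ≤ n, f s = g s) :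
    ∑ s ∈ Finset.range n, edist (f s) (f (s + 1)) =
      ∑ s ∈ Finset.range n, edist (g s) (g (s + 1)) :=
  Finset.sum_congr rfl fun s hs => by
    have := Finset.mem_range.1 hs
    rw [h s (by omega), h (s + 1) (by omega)]

/-- Return to the root along a straight line. -/
theorem OnWalk.onLoop (h : OnWalk root W b) : OnLoop root W (2 * b) := by
  obtain ⟨n, f, h0, hv, hb⟩ := h
  refine ⟨n + 1, fun t => if t ≤ n then f t else root, by simp [h0], by simp, fun v hv' => ?_, ?_⟩
  · obtain ⟨s, hs, rfl⟩ := hv v hv'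
    exact ⟨s, by omega, by simp [hs]⟩
  · rw [Finset.sum_range_succ, two_mul,
      sum_edist_congr (g := f) fun s hs => by simp [hs]]
    refine add_le_add hb ?_
    have : edist (f 0) (f n) ≤ b := (edist_le_range_sum_edist f n).trans hb
    simpa [edist_comm, h0] using this

variable [DecidableEq V]

theorem OnLoop.union (h : OnLoop root W b) (h' : OnLoop root W' b') :
    OnLoop root (W ∪ W') (b + b') := by
  obtain ⟨n, f, h0, hn, hv, hb⟩ := h
  obtain ⟨m, g, g0, gm, hg, hb'⟩ := h'
  have e1 : ∀ s ≤ n, (if s ≤ n then f s else g (s - n)) = f s := fun s hs => by simp [hs]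
  have e2 : ∀ s, (if n + s ≤ n then f (n + s) else g (n + s - n)) = g s := fun s => by
    rcases Nat.eq_zero_or_pos s with rfl | hs
    · simp [hn, g0]
    · rw [if_neg (by omega), Nat.add_sub_cancel_left]
  refine ⟨n + m, fun t => if t ≤ n then f t else g (t - n), by simp [h0], ?_, fun v hv' => ?_, ?_⟩
  · exact (e2 m).trans gm
  · rcases Finset.mem_union.1 hv' with h | h
    · obtain ⟨s, hs, rfl⟩ := hv v h
      exact ⟨s, by omega, e1 s hs⟩
    · obtain ⟨s, hs, rfl⟩ := hg v h
      exact ⟨n + s, by omega, e2 s⟩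
  · rw [Finset.sum_range_add]
    refine add_le_add ((sum_edist_congr e1).trans_le hb) ?_
    simp only [add_assoc, e2]
    exact hb'

theorem OnLoop.biUnion {F : Finset (Finset V)} (h : ∀ T ∈ F, OnLoop root T b) :
    OnLoop root (F.biUnion id) (F.card * b) := by
  induction F using Finset.induction_on with
  | empty => simpa using onLoop_empty
  | insert T F hT ih =>
    rw [Finset.biUnion_insert, Finset.card_insert_of_notMem hT]
    refine ((h T (Finset.mem_insert_self _ _)).union
      (ih fun T' hT' => h T' (Finset.mem_insert_of_mem hT'))).mono subset_rfl ?_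
    push_cast
    rw [add_mul, one_mul, add_comm]

end Walks

namespace Policy

variable {V : Type*} {root : V} (P : Policy V root)

/-- As long as `w` has not been visited, its cost is irrelevant. -/
theorem pos_eq_of_agree {w : V} {c c' : V → ℝ≥0} (hc : ∀ v, v ≠ w → c v = c' v) {t : ℕ}
    (ht : ∀ s < t, P.pos s c ≠ w) :
    (∀ s ≤ t, P.pos s c' = P.pos s c) ∧ (t ≤ P.stopTime c ↔ t ≤ P.stopTime c') := by
  have hagree : ∀ s < t, ∀ u ≤ s, c (P.pos u c) = c' (P.pos u c) := fun s hs u hu =>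
    hc _ (ht u (by omega))
  constructor
  · intro s hs
    rcases s with _ | s
    · rw [P.pos_zero, P.pos_zero]
    · exact (P.nonanticipating s c c' (hagree s (by omega))).2.2.symm
  · have h : ∀ s < t, (P.stopTime c = s ↔ P.stopTime c' = s) := fun s hs =>
      (P.nonanticipating s c c' (hagree s hs)).2.1
    constructor
    · intro h1
      by_contra! h2
      have := (h _ h2).2 rfl
      omega
    · intro h1
      by_contra! h2
      have := (h _ h2).1 rfl
      omega

theorem measurableSet_le_stopTime (t : ℕ) : MeasurableSet {c | t ≤ P.stopTime c} := by
  have : {c | t ≤ P.stopTime c} = ⋂ s ∈ Finset.range t, {c | P.stopTime c = s}ᶜ := by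
    ext c
    simp only [Set.mem_ofPred_eq, Set.mem_iInter, Finset.mem_range, Set.mem_compl_iff]
    exact ⟨fun h s hs => by omega, fun h => by_contra fun h' => h _ (not_le.1 h') rfl⟩
  rw [this]
  exact .biInter (Finset.range t).countable_toSet fun s _ => (P.measurable_stopTime s).compl

theorem measurable_comp_pos [Countable V] (g : V → V → ℝ≥0∞) (s t : ℕ) :
    Measurable fun c => g (P.pos s c) (P.pos t c) := by
  intro S _
  have : (fun c => g (P.pos s c) (P.pos t c)) ⁻¹' S =
      ⋃ v, ⋃ w, {_c | g v w ∈ S} ∩ ({c | P.pos s c = v} ∩ {c | P.pos t c = w}) := by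
    ext c; simp
  rw [this]
  exact .iUnion fun v => .iUnion fun w =>
    .inter (.const _) ((P.measurable_pos s v).inter (P.measurable_pos t w))

variable [PseudoMetricSpace V]

/-- The length of the first `t` moves. -/
noncomputable def walkLength (t : ℕ) (c : V → ℝ≥0) : ℝ≥0∞ :=
  ∑ s ∈ Finset.range t, edist (P.pos s c) (P.pos (s + 1) c)

/-- The walk makes at least `t` moves, and the first `t` moves are within the budget `B`. -/
def Reached (B : ℝ≥0) (t : ℕ) (c : V → ℝ≥0) : Prop :=
  t ≤ P.stopTime c ∧ P.walkLength t c ≤ B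

/-- Within the budget `B`, the vertex `w` is visited, at time `t` for the first time. -/
def FirstHit (B : ℝ≥0) (c : V → ℝ≥0) (w : V) (t : ℕ) : Prop :=
  P.Reached B t c ∧ P.pos t c = w ∧ ∀ s < t, P.pos s c ≠ w

variable {P} {B : ℝ≥0}

theorem walkLength_mono {s t : ℕ} (h : s ≤ t) (c : V → ℝ≥0) :
    P.walkLength s c ≤ P.walkLength t c :=
  Finset.sum_le_sum_of_subset (Finset.range_mono h)

theorem Reached.mono {s t : ℕ} {c : V → ℝ≥0} (h : P.Reached B t c) (hs : s ≤ t) :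
    P.Reached B s c := ⟨hs.trans h.1, (walkLength_mono hs c).trans h.2⟩

theorem exists_firstHit {c : V → ℝ≥0} {t : ℕ} (h : P.Reached B t c) :
    ∃ s ≤ t, P.FirstHit B c (P.pos t c) s := by
  classical
  have hex : ∃ s, P.pos s c = P.pos t c := ⟨t, rfl⟩
  have hle : Nat.find hex ≤ t := Nat.find_min' hex rfl
  exact ⟨Nat.find hex, hle, h.mono hle, Nat.find_spec hex, fun s hs => Nat.find_min hex hs⟩

theorem FirstHit.of_agree {c c' : V → ℝ≥0} {w : V} (hc : ∀ v, v ≠ w → c v = c' v) {t : ℕ}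
    (h : P.FirstHit B c w t) : P.FirstHit B c' w t ∧ ∀ s ≤ t, P.pos s c' = P.pos s c := by
  obtain ⟨h1, h2⟩ := P.pos_eq_of_agree hc h.2.2
  refine ⟨⟨⟨h2.1 h.1.1, ?_⟩, (h1 t le_rfl).trans h.2.1, fun s hs => ?_⟩, h1⟩
  · rw [walkLength, sum_edist_congr (f := fun s => P.pos s c') (g := fun s => P.pos s c) h1]
    exact h.1.2
  · rw [h1 s hs.le]; exact h.2.2 s hs

theorem measurable_walkLength [Countable V] (t : ℕ) : Measurable (P.walkLength t) :=
  Finset.measurable_sum _ fun s _ => P.measurable_comp_pos edist s (s + 1)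

theorem measurableSet_firstHit [Countable V] (w : V) (t : ℕ) :
    MeasurableSet {c | P.FirstHit B c w t} := by
  have : {c | P.FirstHit B c w t} = ({c | t ≤ P.stopTime c} ∩ {c | P.walkLength t c ≤ B}) ∩
      ({c | P.pos t c = w} ∩ ⋂ s ∈ Finset.range t, {c | P.pos s c = w}ᶜ) := by
    ext c; simp [FirstHit, Reached]
  rw [this]
  exact ((P.measurableSet_le_stopTime t).inter
    (measurableSet_le (measurable_walkLength t) measurable_const)).inter
    ((P.measurable_pos t w).inter (.biInter (Finset.range t).countable_toSet
      fun s _ => (P.measurable_pos s w).compl))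

variable [DecidableEq V]

theorem sum_selected_le {c : V → ℝ≥0} (h : P.totalCost c ≤ B) : ∑ v ∈ P.selected c, c v ≤ B := by
  have : ∑ v ∈ P.selected c, (c v : ℝ≥0∞) ≤ B := le_add_self.trans h
  exact_mod_cast this

variable [Fintype V]

open Classical in
variable (P B) in
/-- The exploration of a policy that is aborted when the length of the walk exceeds `B`. -/
noncomputable def exploration : Exploration V where
  visited c := {v | ∃ t, P.FirstHit B c v t}
  before c v w := ∃ t, P.FirstHit B c w t ∧ ∃ s < t, P.pos s c = v
  measurableSet_visited v := by
    simp only [Finset.mem_filter, Finset.mem_univ, true_and]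
    have : {c | ∃ t, P.FirstHit B c v t} = ⋃ t, {c | P.FirstHit B c v t} := by ext; simp
    rw [this]
    exact .iUnion fun t => measurableSet_firstHit v t
  measurableSet_before v w := by
    have : {c | ∃ t, P.FirstHit B c w t ∧ ∃ s < t, P.pos s c = v} =
        ⋃ t, {c | P.FirstHit B c w t} ∩ ⋃ s ∈ Finset.range t, {c | P.pos s c = v} := by
      ext; simp
    rw [this]
    exact .iUnion fun t => (measurableSet_firstHit w t).inter
      (.biUnion (Finset.range t).countable_toSet fun s _ => P.measurable_pos s v)
  visited_update c v x := by
    simp only [Finset.mem_filter, Finset.mem_univ, true_and]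
    exact ⟨fun ⟨t, ht⟩ => ⟨t, (ht.of_agree fun u hu => by simp [hu]).1⟩,
      fun ⟨t, ht⟩ => ⟨t, (ht.of_agree fun u hu => by simp [hu]).1⟩⟩
  before_update c v w x hvw := by
    constructor
    · rintro ⟨t, ht, s, hs, h⟩
      obtain ⟨h1, h2⟩ := ht.of_agree (c' := c) fun u hu => by simp [hu]
      exact ⟨t, h1, s, hs, (h2 s hs.le).trans h⟩
    · rintro ⟨t, ht, s, hs, h⟩
      obtain ⟨h1, h2⟩ := ht.of_agree (c' := update c w x) fun u hu => by simp [hu]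
      exact ⟨t, h1, s, hs, (h2 s hs.le).trans h⟩
  visited_iff c v w hvw := by
    simp only [Finset.mem_filter, Finset.mem_univ, true_and]
    constructor
    · rintro ⟨⟨t, ht⟩, ⟨u, hu⟩⟩
      rcases lt_trichotomy t u with h | rfl | h
      · exact .inl ⟨u, hu, t, h, ht.2.1⟩
      · exact absurd (ht.2.1.symm.trans hu.2.1) hvw
      · exact .inr ⟨t, ht, u, h, hu.2.1⟩
    · rintro (⟨t, ht, s, hs, rfl⟩ | ⟨t, ht, s, hs, rfl⟩)
      · obtain ⟨u, -, hu⟩ := exists_firstHit (ht.1.mono hs.le)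
        exact ⟨⟨u, hu⟩, t, ht⟩
      · obtain ⟨u, -, hu⟩ := exists_firstHit (ht.1.mono hs.le)
        exact ⟨⟨t, ht⟩, u, hu⟩
  not_before c v w hvw := by
    rintro ⟨t, ht, s, hs, h⟩ ⟨t', ht', s', hs', h'⟩
    have h1 : t ≤ s' := not_lt.1 fun hlt => ht.2.2 s' hlt h'
    have h2 : t' ≤ s := not_lt.1 fun hlt => ht'.2.2 s hlt h
    omega

theorem mem_exploration_visited {c : V → ℝ≥0} {v : V} :
    v ∈ (P.exploration B).visited c ↔ ∃ t, P.FirstHit B c v t := by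
  simp [exploration]

theorem onWalk_exploration (c : V → ℝ≥0) : OnWalk root ((P.exploration B).visited c) B := by
  classical
  set n := Nat.findGreatest (fun t => P.Reached B t c) (P.stopTime c) with hn
  have h0 : P.Reached B 0 c := ⟨Nat.zero_le _, by simp [walkLength]⟩
  have hR : P.Reached B n c := Nat.findGreatest_spec (P := fun t => P.Reached B t c)
    (Nat.zero_le _) h0
  refine ⟨n, fun t => P.pos t c, P.pos_zero c, fun v hv => ?_, hR.2⟩
  obtain ⟨t, ht⟩ := mem_exploration_visited.1 hv
  exact ⟨t, Nat.le_findGreatest ht.1.1 ht.1, ht.2.1⟩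

theorem selected_subset_visited {c : V → ℝ≥0} (h : P.totalCost c ≤ B) :
    P.selected c ⊆ (P.exploration B).visited c := by
  intro v hv
  obtain ⟨t, ht, rfl⟩ := Finset.mem_image.1 hv
  have ht' : t ≤ P.stopTime c := by
    have := Finset.mem_range.1 (Finset.mem_filter.1 ht).1; omega
  have hR : P.Reached B t c := ⟨ht', (walkLength_mono ht' c).trans
    (le_self_add.trans (le_self_add.trans h))⟩
  obtain ⟨s, -, hs⟩ := exists_firstHit hR
  exact mem_exploration_visited.2 ⟨s, hs⟩

variable (P) in
theorem measurable_totalCost : Measurable P.totalCost := by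
  classical
  -- the total cost of the walk, if it were stopped at time `n`
  let f : ℕ → (V → ℝ≥0) → ℝ≥0∞ := fun n c => P.walkLength n c + edist (P.pos n c) root +
    ∑ v, {c | ∃ t ≤ n, P.sel t c = true ∧ P.pos t c = v}.indicator (fun c => (c v : ℝ≥0∞)) c
  have hf : ∀ n, Measurable (f n) := by
    intro n
    refine ((measurable_walkLength n).add (P.measurable_comp_pos (fun v _ => edist v root) n n)).add
      (Finset.measurable_sum _ fun v _ => .indicator (by fun_prop) ?_)
    have : {c | ∃ t ≤ n, P.sel t c = true ∧ P.pos t c = v} =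
        ⋃ t ∈ Finset.range (n + 1), {c | P.sel t c = true} ∩ {c | P.pos t c = v} := by
      ext; simp; tauto
    rw [this]
    exact .biUnion (Finset.range (n + 1)).countable_toSet fun t _ =>
      (P.measurable_sel t).inter (P.measurable_pos t v)
  have : P.totalCost = fun c => ∑' n, {c | P.stopTime c = n}.indicator (f n) c := by
    ext c
    rw [tsum_eq_single (P.stopTime c) fun n hn => by simp [hn.symm]]
    simp only [Set.indicator_apply, Set.mem_ofPred_eq, if_true, f]
    rw [totalCost, tourLength]
    congr 1
    rw [← Finset.sum_filter]
    refine Finset.sum_congr ?_ fun _ _ => rfl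
    ext v
    simp [selected, and_assoc]
  rw [this]
  exact .tsum fun n => (hf n).indicator (P.measurable_stopTime n)

end Policy

/-- An exploration restricted to the vertices outside `X`, the costs on `X` being fixed to `h`. -/
def Exploration.condition {V : Type*} [DecidableEq V] (E : Exploration V) (X : Finset V)
    (h : V → ℝ≥0) : Exploration V where
  visited c := E.visited (X.piecewise h c) \ X
  before c v w := v ∉ X ∧ w ∉ X ∧ E.before (X.piecewise h c) v w
  measurableSet_visited v := by
    have hm : Measurable fun c => X.piecewise h c :=
      (measurable_piecewise X).comp measurable_prodMk_left
    simp only [Finset.mem_sdiff]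
    exact (hm (E.measurableSet_visited v)).inter (.const _)
  measurableSet_before v w := by
    have hm : Measurable fun c => X.piecewise h c :=
      (measurable_piecewise X).comp measurable_prodMk_left
    exact .inter (.const _) (.inter (.const _) (hm (E.measurableSet_before v w)))
  visited_update c v x := by
    by_cases hv : v ∈ X
    · simp [hv]
    · rw [← Finset.update_piecewise_of_notMem X h c hv x]
      simp [hv, E.visited_update]
  before_update c v w x hvw := by
    by_cases hw : w ∈ X
    · simp [hw]
    · rw [← Finset.update_piecewise_of_notMem X h c hw x]
      simp [E.before_update _ _ _ _ hvw]
  visited_iff c v w hvw := by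
    have := E.visited_iff (X.piecewise h c) v w hvw
    simp only [Finset.mem_sdiff]
    tauto
  not_before c v w hvw h1 h2 := E.not_before _ v w hvw h1.2.2 h2.2.2

/-! ### One phase -/

section Step

variable {V : Type*}

theorem Cheap.mono_bound {W : Finset V} {r : ℕ} {x y : ℝ≥0} {c : V → ℝ≥0} (h : Cheap W r x c)
    (hxy : x ≤ y) : Cheap W r y c :=
  let ⟨S, hS, hr, hx⟩ := h
  ⟨S, hS, hr, hx.trans hxy⟩

theorem Cheap.congr {W : Finset V} {r : ℕ} {x : ℝ≥0} {c c' : V → ℝ≥0} (h : Cheap W r x c)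
    (hc : ∀ v ∈ W, c v = c' v) : Cheap W r x c' :=
  let ⟨S, hS, hr, hx⟩ := h
  ⟨S, hS, hr, (Finset.sum_congr rfl fun v hv => (hc v (hS hv)).symm).trans_le hx⟩

variable [DecidableEq V]

theorem Cheap.union {X W : Finset V} {r s : ℕ} {x y : ℝ≥0} {c : V → ℝ≥0} (hd : Disjoint X W)
    (h : Cheap X r x c) (h' : Cheap W s y c) : Cheap (X ∪ W) (r + s) (x + y) c := by
  obtain ⟨S, hS, rfl, hx⟩ := h
  obtain ⟨T, hT, rfl, hy⟩ := h'
  have hST : Disjoint S T :=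
    Finset.disjoint_of_subset_left hS (Finset.disjoint_of_subset_right hT hd)
  exact ⟨S ∪ T, Finset.union_subset_union hS hT, Finset.card_union_of_disjoint hST, by
    rw [Finset.sum_union hST]; exact add_le_add hx hy⟩

theorem cheap_piecewise_iff {X W : Finset V} {r : ℕ} {x : ℝ≥0} (c c' : V → ℝ≥0) (h : W ⊆ X) :
    Cheap W r x (X.piecewise c c') ↔ Cheap W r x c :=
  ⟨fun H => H.congr fun v hv => by simp [h hv], fun H => H.congr fun v hv => by simp [h hv]⟩

theorem cheap_piecewise_iff_of_disjoint {X W : Finset V} {r : ℕ} {x : ℝ≥0} (c c' : V → ℝ≥0)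
    (h : Disjoint X W) : Cheap W r x (X.piecewise c c') ↔ Cheap W r x c' := by
  have h' : ∀ v ∈ W, v ∉ X := fun v hv hX => Finset.disjoint_left.1 h hX hv
  exact ⟨fun H => H.congr fun v hv => by simp [h' v hv],
    fun H => H.congr fun v hv => by simp [h' v hv]⟩

variable [Fintype V] {μ : V → Measure ℝ≥0} [∀ v, IsProbabilityMeasure (μ v)]

/-- If `bad` is unlikely compared to `H`, it is unlikely conditionally on some costs on `X`, taken
from `H`. -/
theorem exists_conditional_measure_le (X : Finset V) {bad H : Set (V → ℝ≥0)}
    (hbad : MeasurableSet bad) {δ : ℝ} (hδ : 0 ≤ δ)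
    (h : (Measure.pi μ).real bad < δ * (Measure.pi μ).real H) :
    ∃ c ∈ H, (Measure.pi μ).real {c' | X.piecewise c c' ∈ bad} ≤ δ := by
  by_contra! hcon
  have hm : MeasurableSet ((fun z : (V → ℝ≥0) × (V → ℝ≥0) => X.piecewise z.1 z.2) ⁻¹' bad) :=
    measurable_piecewise X hbad
  have h1 : Measure.pi μ bad = ∫⁻ c, Measure.pi μ {c' | X.piecewise c c' ∈ bad} ∂Measure.pi μ := by
    conv_lhs => rw [← map_piecewise μ X]
    rw [Measure.map_apply (measurable_piecewise X) hbad, Measure.prod_apply hm]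
    rfl
  have h2 : ENNReal.ofReal δ * Measure.pi μ H ≤ Measure.pi μ bad := by
    rw [h1]
    refine le_trans ?_ (mul_meas_ge_le_lintegral (measurable_measure_prodMk_left hm)
      (ENNReal.ofReal δ))
    gcongr
    intro c hc
    have := hcon c hc
    exact ENNReal.ofReal_le_of_le_toReal this.le
  have h3 := ENNReal.toReal_mono (measure_ne_top _ _) h2
  rw [ENNReal.toReal_mul, ENNReal.toReal_ofReal hδ] at h3
  exact absurd h (not_lt.2 h3)

variable [PseudoMetricSpace V] {root : V}

/-- One phase: whatever set `X` has been explored so far, there is a fixed closed walk of length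
`O(B)` that decreases the probability of not having found a cheap set of `k` vertices by a constant
factor, up to a multiple of the probability that the given policy costs more than `B`.

The number of vertices that are missing in `X` is random. For its conditional median `r`, with
probability at least one half `r` more vertices suffice; and there are costs on `X` given which `r`
more vertices are necessary, but the policy still succeeds with probability close to `1`. The
vertices outside `X` that it finds then are independent of what the actual costs on `X` are. -/
theorem exists_phase (P : Policy V root) {k : ℕ} (hP : P.Feasible k) {B : ℝ≥0} (hB : 0 < B)
    (X : Finset V) :
    ∃ W, OnLoop root W (49160 * B) ∧
      (Measure.pi μ).real {c | ¬ Cheap (X ∪ W) k (73729 * B) c} ≤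
        (1 - 1 / 2048) * (Measure.pi μ).real {c | ¬ Cheap X k (73729 * B) c} +
          1024 * (Measure.pi μ).real {c | B < P.totalCost c} := by
  classical
  set ν := Measure.pi μ with hν
  set bad : Set (V → ℝ≥0) := {c | B < P.totalCost c} with hbad
  have hbadm : MeasurableSet bad := measurableSet_lt measurable_const P.measurable_totalCost
  set F : Set (V → ℝ≥0) := {c | ¬ Cheap X k (73729 * B) c} with hF
  have hFm : MeasurableSet F := (measurableSet_cheap X k _).compl
  by_cases hsmall : ν.real F ≤ 1024 * ν.real bad
  · refine ⟨∅, onLoop_empty, ?_⟩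
    rw [Finset.union_empty]
    have : 0 ≤ ν.real F := measureReal_nonneg
    linarith
  rw [not_le] at hsmall
  have hF0 : 0 < ν.real F := lt_of_le_of_lt (by positivity) hsmall
  let R : ℕ → Set (V → ℝ≥0) := fun j => {c | Cheap X (k - j) B c}
  have hRm : ∀ j, MeasurableSet (R j) := fun j => measurableSet_cheap X _ _
  -- the median: the least `j` such that `j` more vertices suffice on half of the event `F`
  have hex : ∃ j, ν.real F / 2 ≤ ν.real (F ∩ R j) := ⟨k, by
    have : F ∩ R k = F := Set.inter_eq_left.2 fun c _ =>
      ⟨∅, Finset.empty_subset _, by simp, by simp⟩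
    rw [this]; linarith⟩
  have hr := Nat.find_spec hex
  have hmin := fun m => Nat.find_min hex (m := m)
  have hrk : Nat.find hex ≤ k := Nat.find_min' hex (by
    have : F ∩ R k = F := Set.inter_eq_left.2 fun c _ =>
      ⟨∅, Finset.empty_subset _, by simp, by simp⟩
    rw [this]; linarith)
  generalize Nat.find hex = r at hr hmin hrk
  obtain ⟨m, rfl⟩ : ∃ m, r = m + 1 := by
    refine Nat.exists_eq_succ_of_ne_zero fun h0 => ?_
    rw [h0] at hr
    have : F ∩ R 0 = ∅ := by
      ext c
      simp only [Set.mem_inter_iff, Set.mem_empty_iff_false, iff_false, not_and]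
      exact fun h1 h2 => h1 (Cheap.mono_bound (h2 : Cheap X k B c)
        (le_mul_of_one_le_left zero_le (by norm_num)))
    rw [this, measureReal_empty] at hr
    linarith
  have hm := hmin m (Nat.lt_succ_self m)
  have hH : ν.real F / 2 < ν.real (F \ R m) := by
    have := measureReal_inter_add_sdiff (μ := ν) (s := F) (hRm m)
    linarith
  obtain ⟨h, ⟨-, hhR⟩, hh⟩ := exists_conditional_measure_le (μ := μ) X hbadm
    (δ := 1 / 512) (by norm_num) (H := F \ R m) (by linarith)
  -- conditionally on the costs `h` on `X`, the policy finds `m + 1` cheap vertices outside `X`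
  set E := (P.exploration B).condition X h with hE
  have hG : 511 / 512 ≤ ν.real {c | Cheap (E.visited c) (m + 1) B c} := by
    have hpm : Measurable fun c => X.piecewise h c :=
      (measurable_piecewise X).comp measurable_prodMk_left
    have hsub : {c | X.piecewise h c ∈ bad}ᶜ ⊆ {c | Cheap (E.visited c) (m + 1) B c} := by
      intro c hc
      have hle : P.totalCost (X.piecewise h c) ≤ B := not_lt.1 hc
      have hvis := Policy.selected_subset_visited hle
      have hsum := Policy.sum_selected_le hle
      have hcard := hP (X.piecewise h c)
      set S := P.selected (X.piecewise h c) with hS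
      have hSX : (S ∩ X).card < k - m := by
        by_contra! hcon
        obtain ⟨S', hS', hS'c⟩ := Finset.exists_subset_card_eq hcon
        refine hhR ⟨S', hS'.trans Finset.inter_subset_right, hS'c, ?_⟩
        refine le_trans ?_ hsum
        calc ∑ v ∈ S', h v = ∑ v ∈ S', X.piecewise h c v := Finset.sum_congr rfl fun v hv => by
              simp [(Finset.mem_inter.1 (hS' hv)).2]
          _ ≤ _ := Finset.sum_le_sum_of_subset (hS'.trans Finset.inter_subset_left)
      have hSc : m + 1 ≤ (S \ X).card := by
        have := Finset.card_inter_add_card_sdiff S X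
        omega
      obtain ⟨S', hS', hS'c⟩ := Finset.exists_subset_card_eq hSc
      refine ⟨S', hS'.trans (Finset.sdiff_subset_sdiff hvis subset_rfl), hS'c, ?_⟩
      refine le_trans ?_ hsum
      calc ∑ v ∈ S', c v = ∑ v ∈ S', X.piecewise h c v := Finset.sum_congr rfl fun v hv => by
            simp [(Finset.mem_sdiff.1 (hS' hv)).2]
        _ ≤ _ := Finset.sum_le_sum_of_subset (hS'.trans Finset.sdiff_subset)
    refine le_trans ?_ (measureReal_mono (μ := ν) hsub)
    have := probReal_compl_eq_one_sub (μ := ν) (hpm hbadm)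
    have h1 : ν.real {c | X.piecewise h c ∈ bad}ᶜ = 1 - ν.real {c | X.piecewise h c ∈ bad} := this
    rw [h1]
    linarith
  let 𝒯 : Finset (Finset V) := {T | OnWalk root T B ∧ Disjoint X T}
  have h𝒯 : ∀ c, E.visited c ∈ 𝒯 := fun c => by
    simp only [𝒯, Finset.mem_filter, Finset.mem_univ, true_and]
    exact ⟨(Policy.onWalk_exploration _).mono Finset.sdiff_subset, Finset.disjoint_sdiff⟩
  obtain ⟨A, hA, hAc, hAP⟩ := exists_union_cheap E h𝒯 hB hG
  set W := A.biUnion id with hW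
  have hXW : Disjoint X W := (Finset.disjoint_biUnion_right _ _ _).2 fun T hT =>
    (Finset.mem_filter.1 (hA hT)).2.2
  refine ⟨W, ?_, ?_⟩
  · refine (OnLoop.biUnion fun T hT => (Finset.mem_filter.1 (hA hT)).2.1.onLoop).mono subset_rfl ?_
    rw [← mul_assoc]
    gcongr
    have : (A.card : ℝ≥0∞) ≤ 24580 := by exact_mod_cast hAc
    calc (A.card : ℝ≥0∞) * 2 ≤ 24580 * 2 := by gcongr
      _ = 49160 := by norm_num
  · set G : Set (V → ℝ≥0) := {c | Cheap W (m + 1) (73728 * B) c} with hGd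
    have hGm : MeasurableSet G := measurableSet_cheap _ _ _
    have hind : ν.real ((F ∩ R (m + 1)) ∩ G) = ν.real (F ∩ R (m + 1)) * ν.real G := by
      rw [measureReal_def, measure_inter_of_piecewise μ X (hFm.inter (hRm _)) hGm,
        ENNReal.toReal_mul]
      · rfl
      · intro c c'
        simp only [F, R, Set.mem_inter_iff, Set.mem_ofPred_eq, cheap_piecewise_iff c c' subset_rfl]
      · intro c c'
        exact cheap_piecewise_iff_of_disjoint c c' hXW
    have hsub : {c | ¬ Cheap (X ∪ W) k (73729 * B) c} ⊆ F \ ((F ∩ R (m + 1)) ∩ G) := by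
      intro c hc
      refine ⟨fun hcon => hc ?_, fun hcon => hc ?_⟩
      · obtain ⟨S, hS, h1, h2⟩ := hcon
        exact ⟨S, hS.trans Finset.subset_union_left, h1, h2⟩
      · have := Cheap.union hXW hcon.1.2 hcon.2
        rw [Nat.sub_add_cancel hrk] at this
        exact this.mono_bound (by rw [← one_add_mul]; norm_num)
    have h1 := measureReal_mono (μ := ν) hsub
    rw [measureReal_sdiff (fun c hc => hc.1.1) ((hFm.inter (hRm _)).inter hGm), hind] at h1
    have h2 : ν.real F / 2 * (1 / 1024) ≤ ν.real (F ∩ R (m + 1)) * ν.real G := by gcongr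
    have h3 : 0 ≤ ν.real bad := measureReal_nonneg
    linarith

end Step

/-! ### Non-adaptive policies from closed walks -/

section Concatenation

variable {V : Type*} {root : V}

/-- The start of the `i`-th of consecutive walks with `n 0, n 1, …` moves. -/
def startTime (n : ℕ → ℕ) (i : ℕ) : ℕ := ∑ j ∈ Finset.range i, n j

theorem startTime_succ (n : ℕ → ℕ) (i : ℕ) : startTime n (i + 1) = startTime n i + n i :=
  Finset.sum_range_succ _ _

theorem startTime_mono (n : ℕ → ℕ) : Monotone (startTime n) :=
  monotone_nat_of_le_succ fun i => by rw [startTime_succ]; omega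

theorem apply_startTime {n : ℕ → ℕ} {F : ℕ → ℕ → V} (hn : ∀ i, F i (n i) = root) {J : ℕ}
    {f : ℕ → V} (f0 : f 0 = root) (hf : ∀ i < J, ∀ s ≤ n i, f (startTime n i + s) = F i s)
    {i : ℕ} (hi : i ≤ J) :
    f (startTime n i) = root := by
  rcases i with _ | i
  · simpa [startTime] using f0
  · rw [startTime_succ, hf i hi _ le_rfl, hn]

/-- The closed walks `F 0, …, F (J - 1)`, the `i`-th one with `n i` moves, joined at the root. -/
theorem exists_concatenation {n : ℕ → ℕ} {F : ℕ → ℕ → V} (h0 : ∀ i, F i 0 = root)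
    (hn : ∀ i, F i (n i) = root) (J : ℕ) :
    ∃ f : ℕ → V, f 0 = root ∧ ∀ i < J, ∀ s ≤ n i, f (startTime n i + s) = F i s := by
  induction J with
  | zero => exact ⟨fun _ => root, rfl, by simp⟩
  | succ J ih =>
    obtain ⟨f, f0, hf⟩ := ih
    have hJ := apply_startTime hn f0 hf le_rfl
    refine ⟨fun t => if t ≤ startTime n J then f t else F J (t - startTime n J), by simp [f0],
      fun i hi s hs => ?_⟩
    rcases Nat.lt_succ_iff_lt_or_eq.1 hi with hi | rfl
    · have : startTime n i + s ≤ startTime n J :=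
        le_trans (by rw [startTime_succ]; omega) (startTime_mono n (Nat.succ_le_of_lt hi))
      simp only [this, if_true]
      exact hf i hi s hs
    · rcases Nat.eq_zero_or_pos s with rfl | hs'
      · simp [hJ, h0]
      · simp only [show ¬ startTime n i + s ≤ startTime n i by omega, if_false,
          Nat.add_sub_cancel_left]

theorem sum_edist_concatenation [PseudoMetricSpace V] {n : ℕ → ℕ} {F : ℕ → ℕ → V} {J : ℕ}
    {f : ℕ → V} (hf : ∀ i < J, ∀ s ≤ n i, f (startTime n i + s) = F i s) {j : ℕ} (hj : j ≤ J) :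
    ∑ t ∈ Finset.range (startTime n j), edist (f t) (f (t + 1)) =
      ∑ i ∈ Finset.range j, ∑ s ∈ Finset.range (n i), edist (F i s) (F i (s + 1)) := by
  induction j with
  | zero => simp [startTime]
  | succ j ih =>
    rw [startTime_succ, Finset.sum_range_add, ih (by omega), Finset.sum_range_succ]
    congr 1
    exact sum_edist_congr (f := fun s => f (startTime n j + s)) fun s hs => hf j (by omega) s hs

end Concatenation

section Construction

variable {V : Type*} [DecidableEq V] [PseudoMetricSpace V] {root : V}

/-- The non-adaptive policy given by consecutive closed walks through growing sets `X i` and a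
numbered list of candidates. The candidate `m` is the selection `S m`; it may be taken if `p m`
holds, a condition on the costs on `X (ι m)`, which are known when the walk through `X (ι m)` is
over. The first admissible candidate is selected on the next walk. -/
theorem exists_nonAdaptive_of_candidates {k J : ℕ} {X : ℕ → Finset V} (hX : Monotone X)
    {b : ℕ → ℝ≥0∞} (hloop : ∀ i, OnLoop root (X i) (b i)) {ι : ℕ → ℕ} (hι : Monotone ι)
    {S : ℕ → Finset V} {p : ℕ → (V → ℝ≥0) → Prop} (hpm : ∀ m, MeasurableSet {c | p m c})
    (hp : ∀ m c, p m c → S m ⊆ X (ι m) ∧ (S m).card = k ∧ ι m + 2 ≤ J)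
    (hpX : ∀ m c c', (∀ v ∈ X (ι m), c v = c' v) → p m c → p m c') (hex : ∀ c, ∃ m, p m c) :
    ∃ P : Policy V root, P.Feasible k ∧ P.NonAdaptive ∧ ∀ c, ∃ m, p m c ∧ (∀ j < m, ¬ p j c) ∧
      P.totalCost c ≤ ∑ i ∈ Finset.range (ι m + 2), b i + ∑ v ∈ S m, (c v : ℝ≥0∞) := by
  classical
  choose n F F0 Fn hFX hFb using hloop
  obtain ⟨f, f0, hf⟩ := exists_concatenation F0 Fn J
  set T := startTime n with hT
  have hTm : Monotone T := startTime_mono n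
  let M : (V → ℝ≥0) → ℕ := fun c => Nat.find (hex c)
  have hM : ∀ c, p (M c) c := fun c => Nat.find_spec (hex c)
  have hMmin : ∀ c, ∀ j < M c, ¬ p j c := fun c j hj => Nat.find_min (hex c) hj
  have hMeq : ∀ c m, M c = m ↔ p m c ∧ ∀ j < m, ¬ p j c := fun c m => Nat.find_eq_iff (hex c)
  have hMm : ∀ m, MeasurableSet {c | M c = m} := by
    intro m
    have : {c | M c = m} = {c | p m c} ∩ ⋂ j ∈ Finset.range m, {c | p j c}ᶜ := by
      ext c; simp [hMeq]
    rw [this]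
    exact (hpm m).inter (.biInter (Finset.range m).countable_toSet fun j _ => (hpm j).compl)
  -- the costs on `X i` are known at the time `T (i + 1)`
  have hknown : ∀ {c c' : V → ℝ≥0} {t i : ℕ}, (∀ s ≤ t, c (f s) = c' (f s)) → i < J →
      T (i + 1) ≤ t → ∀ v ∈ X i, c v = c' v := by
    intro c c' t i hc hi ht v hv
    obtain ⟨s, hs, rfl⟩ := hFX i v hv
    rw [← hf i hi s hs]
    refine hc _ (le_trans ?_ ht)
    rw [hT, startTime_succ]
    exact Nat.add_le_add_left hs _
  have hkey : ∀ {c c' : V → ℝ≥0} {t : ℕ}, (∀ s ≤ t, c (f s) = c' (f s)) →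
      T (ι (M c) + 1) ≤ t → M c' = M c := by
    intro c c' t hc ht
    have hJ := (hp _ _ (hM c)).2.2
    have hle : ∀ j ≤ M c, ∀ v ∈ X (ι j), c v = c' v := fun j hj =>
      hknown hc (by have := hι hj; omega) ((hTm (Nat.succ_le_succ (hι hj))).trans ht)
    refine (hMeq c' _).2 ⟨hpX _ c c' (hle _ le_rfl) (hM c), fun j hj hj' => ?_⟩
    exact hMmin c j hj (hpX _ c' c (fun v hv => (hle j hj.le v hv).symm) hj')
  let P : Policy V root :=
    { pos := fun t _ => f t
      sel := fun t c => decide (T (ι (M c) + 1) ≤ t ∧ f t ∈ S (M c))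
      stopTime := fun c => T (ι (M c) + 2)
      pos_zero := fun _ => f0
      nonanticipating := by
        intro t c c' hc
        suffices M c' = M c ∨ (t < T (ι (M c) + 1) ∧ t < T (ι (M c') + 1)) by
          rcases this with h | ⟨h, h'⟩
          · rw [h]; exact ⟨rfl, Iff.rfl, rfl⟩
          · have h1 : T (ι (M c) + 1) ≤ T (ι (M c) + 2) := hTm (Nat.le_succ _)
            have h1' : T (ι (M c') + 1) ≤ T (ι (M c') + 2) := hTm (Nat.le_succ _)
            refine ⟨?_, ?_, rfl⟩
            · simp [not_le.2 h, not_le.2 h']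
            · constructor <;> intro h2 <;> omega
        by_cases h : T (ι (M c) + 1) ≤ t
        · exact .inl (hkey hc h)
        · by_cases h' : T (ι (M c') + 1) ≤ t
          · exact .inl (hkey (fun s hs => (hc s hs).symm) h').symm
          · exact .inr ⟨not_le.1 h, not_le.1 h'⟩
      measurable_pos := fun t v => .const _
      measurable_sel := by
        intro t
        have : {c | decide (T (ι (M c) + 1) ≤ t ∧ f t ∈ S (M c)) = true} =
            ⋃ m, {c | M c = m} ∩ {_c | T (ι m + 1) ≤ t ∧ f t ∈ S m} := by
          ext c; simp
        rw [this]
        exact .iUnion fun m => (hMm m).inter (.const _)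
      measurable_stopTime := by
        intro t
        have : {c | T (ι (M c) + 2) = t} = ⋃ m, {c | M c = m} ∩ {_c | T (ι m + 2) = t} := by
          ext c; simp
        rw [this]
        exact .iUnion fun m => (hMm m).inter (.const _) }
  have hsel : ∀ c, P.selected c = S (M c) := by
    intro c
    obtain ⟨hS, -, hJ⟩ := hp _ _ (hM c)
    ext v
    simp only [Policy.selected, P, Finset.mem_image, Finset.mem_filter, Finset.mem_range,
      decide_eq_true_eq]
    constructor
    · rintro ⟨t, ⟨-, -, h⟩, rfl⟩
      exact h
    · intro hv
      obtain ⟨s, hs, hsv⟩ := hFX (ι (M c) + 1) v (hX (Nat.le_succ _) (hS hv))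
      have h1 := hf (ι (M c) + 1) (by omega) s hs
      have h2 : T (ι (M c) + 2) = T (ι (M c) + 1) + n (ι (M c) + 1) := startTime_succ _ _
      refine ⟨T (ι (M c) + 1) + s, ⟨by omega, by omega, ?_⟩, h1.trans hsv⟩
      rw [h1, hsv]; exact hv
  refine ⟨P, fun c => by rw [hsel]; exact (hp _ _ (hM c)).2.1,
    ⟨(List.range (T J)).map fun t => f (t + 1), fun c t ht => ?_⟩,
    fun c => ⟨M c, hM c, hMmin c, ?_⟩⟩
  · have ht' : t ≤ T J := ht.trans (hTm (hp _ _ (hM c)).2.2)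
    rcases t with _ | t
    · simp [P, f0]
    · have : t < T J := ht'
      simp [P, this]
  · have hJ := (hp _ _ (hM c)).2.2
    rw [Policy.totalCost, hsel]
    gcongr
    show ∑ t ∈ Finset.range (T (ι (M c) + 2)), edist (f t) (f (t + 1)) +
      edist (f (T (ι (M c) + 2))) root ≤ _
    rw [sum_edist_concatenation hf hJ, apply_startTime Fn f0 hf hJ, edist_self, add_zero]
    exact Finset.sum_le_sum fun i _ => hFb i

variable [Fintype V]

/-- The non-adaptive policy that, for `i < I`, stops after exploring `X i` if `k` vertices of total
cost at most `x i` have been found, and otherwise selects the cheapest `k` vertices of `X I`. -/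
theorem exists_nonAdaptive_of_phases {k I : ℕ} {X : ℕ → Finset V} (hX : Monotone X)
    {b : ℕ → ℝ≥0∞} (hloop : ∀ i, OnLoop root (X i) (b i)) (x : ℕ → ℝ≥0) (hk : k ≤ (X I).card) :
    ∃ P : Policy V root, P.Feasible k ∧ P.NonAdaptive ∧ ∀ c,
      (∃ i < I, (∀ j < i, ¬ Cheap (X j) k (x j) c) ∧
        P.totalCost c ≤ ∑ j ∈ Finset.range (i + 2), b j + x i) ∨
      ((∀ j < I, ¬ Cheap (X j) k (x j) c) ∧ ∀ S ⊆ X I, S.card = k →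
        P.totalCost c ≤ ∑ j ∈ Finset.range (I + 2), b j + ∑ v ∈ S, (c v : ℝ≥0∞)) := by
  classical
  -- the candidate `j * N + e S` is the selection of `S` after exploring `X j`
  set N := Fintype.card (Finset V) with hN
  have hN0 : 0 < N := Fintype.card_pos
  let e : Finset V ≃ Fin N := Fintype.equivFin _
  let S : ℕ → Finset V := fun m => e.symm ⟨m % N, Nat.mod_lt _ hN0⟩
  let p : ℕ → (V → ℝ≥0) → Prop := fun m c => (S m ⊆ X (m / N) ∧ (S m).card = k ∧ m / N ≤ I) ∧
    (m / N < I → ∑ v ∈ S m, c v ≤ x (m / N)) ∧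
    (m / N = I → ∀ S', (S' ⊆ X I ∧ S'.card = k) → ∑ v ∈ S m, c v ≤ ∑ v ∈ S', c v)
  have hidx : ∀ j (A : Finset V), (j * N + e A) / N = j ∧ S (j * N + e A) = A := by
    intro j A
    have hlt : (e A : ℕ) < N := (e A).2
    have hmod : (j * N + e A) % N = e A := by
      rw [Nat.add_comm, Nat.add_mul_mod_self_right, Nat.mod_eq_of_lt hlt]
    constructor
    · rw [Nat.add_comm, Nat.add_mul_div_right _ _ hN0, Nat.div_eq_of_lt hlt, zero_add]
    · simp only [S, hmod, Fin.eta, Equiv.symm_apply_apply]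
  have hpm : ∀ m, MeasurableSet {c | p m c} := by
    intro m
    have hle : ∀ S' : Finset V, MeasurableSet {c : V → ℝ≥0 | ∑ v ∈ S m, c v ≤ ∑ v ∈ S', c v} :=
      fun S' => measurableSet_le (Finset.measurable_sum _ fun v _ => measurable_pi_apply v)
        (Finset.measurable_sum _ fun v _ => measurable_pi_apply v)
    have himp : ∀ (q : Prop) (A : Set (V → ℝ≥0)), MeasurableSet A →
        MeasurableSet {c | q → c ∈ A} := by
      intro q A hA
      by_cases hq : q <;> simp [hq, hA]
    refine .inter (.const _) (.inter (himp _ _ (measurableSet_sum_le (S m) _)) (himp _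
      {c | ∀ S', (S' ⊆ X I ∧ S'.card = k) → ∑ v ∈ S m, c v ≤ ∑ v ∈ S', c v} ?_))
    have : {c : V → ℝ≥0 | ∀ S', (S' ⊆ X I ∧ S'.card = k) → ∑ v ∈ S m, c v ≤ ∑ v ∈ S', c v} =
        ⋂ S', {c | (S' ⊆ X I ∧ S'.card = k) → c ∈ {c | ∑ v ∈ S m, c v ≤ ∑ v ∈ S', c v}} := by
      ext c; simp
    rw [this]
    exact .iInter fun S' => himp _ _ (hle S')
  obtain ⟨P, hP, hPn, hPc⟩ := exists_nonAdaptive_of_candidates (root := root) (k := k) (J := I + 2)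
    hX hloop (ι := fun m => m / N) (fun m m' h => Nat.div_le_div_right h) (S := S) (p := p) hpm
    (fun m c h => ⟨h.1.1, h.1.2.1, by have := h.1.2.2; omega⟩)
    (fun m c c' hc h => by
      have hsum : ∀ A ⊆ X (m / N), ∑ v ∈ A, c' v = ∑ v ∈ A, c v := fun A hA =>
        Finset.sum_congr rfl fun v hv => (hc v (hA hv)).symm
      refine ⟨h.1, fun hI => ?_, fun hI A hA => ?_⟩
      · rw [hsum _ h.1.1]; exact h.2.1 hI
      · rw [hsum _ h.1.1, hsum _ (by rw [hI]; exact hA.1)]; exact h.2.2 hI A hA)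
    (fun c => by
      obtain ⟨A₀, hA₀, hA₀k⟩ := Finset.exists_subset_card_eq hk
      obtain ⟨A, hA, hmin⟩ := Finset.exists_min_image ((X I).powersetCard k)
        (fun A => ∑ v ∈ A, c v) ⟨A₀, Finset.mem_powersetCard.2 ⟨hA₀, hA₀k⟩⟩
      rw [Finset.mem_powersetCard] at hA
      obtain ⟨h1, h2⟩ := hidx I A
      refine ⟨I * N + e A, ?_⟩
      simp only [p, h1, h2]
      exact ⟨⟨hA.1, hA.2, le_rfl⟩, fun h => absurd h (lt_irrefl _), fun _ A' hA' =>
        hmin A' (Finset.mem_powersetCard.2 hA')⟩)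
  refine ⟨P, hP, hPn, fun c => ?_⟩
  obtain ⟨m, hm, hmmin, hcost⟩ := hPc c
  obtain ⟨⟨hmX, hmk, hmI⟩, hm1, hm2⟩ := hm
  have hnot : ∀ j < m / N, j < I → ¬ Cheap (X j) k (x j) c := by
    rintro j hj hjI ⟨A, hA, hAk, hAx⟩
    obtain ⟨h1, h2⟩ := hidx j A
    refine hmmin (j * N + e A) ?_ ?_
    · by_contra! hcon
      have := Nat.div_le_div_right (c := N) hcon
      omega
    · simp only [p, h1, h2]
      exact ⟨⟨hA, hAk, hjI.le⟩, fun _ => hAx, fun h => absurd h hjI.ne⟩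
  rcases hmI.lt_or_eq with hlt | heq
  · refine .inl ⟨m / N, hlt, fun j hj => hnot j hj (hj.trans hlt), hcost.trans ?_⟩
    gcongr
    exact_mod_cast hm1 hlt
  · refine .inr ⟨fun j hj => hnot j (by omega) hj, fun A hA hAk => hcost.trans ?_⟩
    simp only [heq]
    have : ∑ v ∈ S m, (c v : ℝ≥0∞) ≤ ∑ v ∈ A, (c v : ℝ≥0∞) := by
      exact_mod_cast hm2 heq A ⟨hA, hAk⟩
    gcongr

end Construction

/-! ### Geometric budgets -/

section Assembly

variable {V : Type*} [Fintype V] [DecidableEq V] [PseudoMetricSpace V] {root : V}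

theorem onLoop_of_edist_le {W : Finset V} {b : ℝ≥0∞} (h : ∀ v ∈ W, edist root v ≤ b) :
    OnLoop root W (Fintype.card V * (2 * b)) := by
  have h1 := OnLoop.biUnion (root := root) (F := W.image fun v => ({v} : Finset V)) (b := 2 * b)
    fun T hT => by
      obtain ⟨v, hv, rfl⟩ := Finset.mem_image.1 hT
      exact OnWalk.onLoop ⟨1, fun t => if t = 0 then root else v, rfl,
        fun w hw => ⟨1, le_rfl, by simpa using (Finset.mem_singleton.1 hw).symm⟩,
        by simpa using h v hv⟩
  refine h1.mono (fun v hv => ?_) ?_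
  · simpa using hv
  · gcongr
    exact Finset.card_image_le.trans (Finset.card_le_univ W)

theorem exists_onLoop_univ (root : V) : ∃ b : ℝ≥0, OnLoop root Finset.univ b := by
  have h : ∀ v ∈ (Finset.univ : Finset V), edist root v ≤ ∑ w, edist root w := fun v hv =>
    Finset.single_le_sum (f := fun w => edist root w) (fun _ _ => zero_le) hv
  have hfin : (Fintype.card V : ℝ≥0∞) * (2 * ∑ w, edist root w) ≠ ⊤ :=
    ENNReal.mul_ne_top (ENNReal.natCast_ne_top _) (ENNReal.mul_ne_top ENNReal.ofNat_ne_top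
      (ENNReal.sum_ne_top.2 fun w _ => edist_ne_top _ _))
  refine ⟨((Fintype.card V : ℝ≥0∞) * (2 * ∑ w, edist root w)).toNNReal, ?_⟩
  rw [ENNReal.coe_toNNReal hfin]
  exact onLoop_of_edist_le h

/-- The budget of the `i`-th phase. The growth factor is so close to `1` that the constant factor by
which a phase decreases the probability of failure makes up for it. -/
noncomputable def budget (b₀ : ℝ≥0) (i : ℕ) : ℝ≥0 := b₀ * (4097 / 4096) ^ i

theorem budget_succ (b₀ : ℝ≥0) (i : ℕ) : budget b₀ (i + 1) = 4097 / 4096 * budget b₀ i := by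
  rw [budget, budget, pow_succ]; ring

theorem budget_mono (b₀ : ℝ≥0) : Monotone (budget b₀) :=
  monotone_nat_of_le_succ fun i => by
    rw [budget_succ]
    refine le_mul_of_one_le_left zero_le ?_
    rw [one_le_div (by norm_num)]; norm_num

theorem sum_budget_le (b₀ : ℝ≥0) (i : ℕ) :
    ∑ j ∈ Finset.range (i + 1), budget b₀ j ≤ 4097 * budget b₀ i := by
  induction i with
  | zero =>
    rw [zero_add, Finset.sum_range_one]
    exact le_mul_of_one_le_left zero_le (by norm_num)
  | succ i ih =>
    rw [Finset.sum_range_succ]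
    have h : (4097 : ℝ≥0) * budget b₀ i + budget b₀ (i + 1) = 4097 * budget b₀ (i + 1) := by
      rw [budget_succ]
      have : (4097 : ℝ≥0) * budget b₀ i + 4097 / 4096 * budget b₀ i =
        (4097 + 4097 / 4096) * budget b₀ i := by ring
      rw [this, ← mul_assoc]
      congr 1
      norm_num
    exact (add_le_add_left ih _).trans h.le

/-- The budgets below `x` form a geometric series, dominated by `x`. -/
theorem sum_budget_lt_le (b₀ : ℝ≥0) (x : ℝ≥0∞) (I : ℕ) :
    ∑ i ∈ Finset.range I, (if (budget b₀ i : ℝ≥0∞) < x then (budget b₀ i : ℝ≥0∞) else 0) ≤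
      4097 * x := by
  induction I with
  | zero => simp
  | succ I ih =>
    by_cases h : (budget b₀ I : ℝ≥0∞) < x
    · calc ∑ i ∈ Finset.range (I + 1),
            (if (budget b₀ i : ℝ≥0∞) < x then (budget b₀ i : ℝ≥0∞) else 0)
          ≤ ∑ i ∈ Finset.range (I + 1), (budget b₀ i : ℝ≥0∞) :=
            Finset.sum_le_sum fun i _ => by split_ifs <;> simp
        _ ≤ ((4097 * budget b₀ I : ℝ≥0) : ℝ≥0∞) := by exact_mod_cast sum_budget_le b₀ I
        _ ≤ 4097 * x := by push_cast; gcongr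
    · rw [Finset.sum_range_succ, if_neg h, add_zero]
      exact ih

/-- A failure probability `g` that decreases by the factor `1 - 1 / 2048` in each phase outweighs
budgets `B` that grow by the factor `4097 / 4096`. -/
theorem sum_mul_le_of_recurrence {B g p : ℕ → ℝ} (hB0 : ∀ i, 0 ≤ B i)
    (hB : ∀ i, B (i + 1) = 4097 / 4096 * B i) (hg0 : g 0 = 1) (hg : ∀ i, 0 ≤ g i)
    (hp : ∀ i, 0 ≤ p i) (h : ∀ i, g (i + 1) ≤ (1 - 1 / 2048) * g i + 1024 * p i) (I : ℕ) :
    ∑ i ∈ Finset.range (I + 1), B i * g i ≤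
      4096 * (B 0 + 2048 * ∑ i ∈ Finset.range I, B i * p i) := by
  -- the term `4095 * (B I * g I)` pays for all later phases, up to the terms with `p`
  suffices ∑ i ∈ Finset.range (I + 1), B i * g i + 4095 * (B I * g I) ≤
      4096 * (B 0 + 2048 * ∑ i ∈ Finset.range I, B i * p i) by
    have := mul_nonneg (hB0 I) (hg I)
    linarith
  induction I with
  | zero => simp [hg0]; linarith
  | succ I ih =>
    rw [Finset.sum_range_succ _ (I + 1), Finset.sum_range_succ (fun i => B i * p i) I]
    have h1 : B (I + 1) * g (I + 1) ≤
        4097 / 4096 * ((1 - 1 / 2048) * (B I * g I) + 1024 * (B I * p I)) := by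
      rw [hB]
      have := mul_le_mul_of_nonneg_left (h I) (hB0 I)
      linarith
    have h2 := mul_nonneg (hB0 I) (hg I)
    have h3 := mul_nonneg (hB0 I) (hp I)
    linarith

/-- The constant of the adaptivity gap that the argument gives. -/
noncomputable def gapConstant : ℝ≥0 :=
  (49160 * 4097 * 8194 + 73729) * (4096 * (1 + 2048 * 8194)) + 2

variable {μ : V → Measure ℝ≥0} [∀ v, IsProbabilityMeasure (μ v)]

/-- A policy of finite cost is turned into a non-adaptive one by phases with geometrically growing
budgets. A phase with budget `B i` takes place only if the one before has failed, and costs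
`O(B i)`; the expected total is then governed by the recurrence for the failure probabilities. -/
theorem exists_nonAdaptive_of_pos {k : ℕ} {b₀ : ℝ≥0} (hb₀ : 0 < b₀) (P₀ : Policy V root)
    (hP₀ : P₀.Feasible k) (hcost : P₀.expectedCost μ ≤ 2 * b₀) :
    ∃ P : Policy V root, P.Feasible k ∧ P.NonAdaptive ∧ P.expectedCost μ ≤ gapConstant * b₀ := by
  classical
  set ν := Measure.pi μ with hν
  set B := budget b₀ with hB
  have hB0 : ∀ i, 0 < B i := fun i => by simp only [hB, budget]; positivity
  choose W hWloop hW using fun (i : ℕ) (X : Finset V) => exists_phase (μ := μ) P₀ hP₀ (hB0 i) X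
  -- `X i` is the set explored in the first `i` phases; each phase is chosen knowing only `X i`
  let X : ℕ → Finset V := fun i => Nat.rec ∅ (fun i Y => Y ∪ W i Y) i
  have hXs : ∀ i, X (i + 1) = X i ∪ W i (X i) := fun i => rfl
  have hXmono : Monotone X := monotone_nat_of_le_succ fun i => by
    rw [hXs]; exact Finset.subset_union_left
  have hXloop : ∀ i, OnLoop root (X i) (∑ j ∈ Finset.range i, 49160 * (B j : ℝ≥0∞)) := by
    intro i
    induction i with
    | zero => exact onLoop_empty
    | succ i ih => rw [hXs, Finset.sum_range_succ]; exact ih.union (hWloop i (X i))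
  have hXloop' : ∀ i, OnLoop root (X (i + 1)) ((49160 * 4097 * B i : ℝ≥0) : ℝ≥0∞) := by
    intro i
    refine (hXloop (i + 1)).mono subset_rfl ?_
    rw [← Finset.mul_sum, mul_assoc]
    have : ∑ j ∈ Finset.range (i + 1), (B j : ℝ≥0∞) ≤ ((4097 * B i : ℝ≥0) : ℝ≥0∞) := by
      exact_mod_cast sum_budget_le b₀ i
    calc (49160 : ℝ≥0∞) * ∑ j ∈ Finset.range (i + 1), (B j : ℝ≥0∞)
        ≤ 49160 * ((4097 * B i : ℝ≥0) : ℝ≥0∞) := by gcongr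
      _ = _ := by push_cast; ring
  -- the last phase visits all vertices
  obtain ⟨bU, hbU⟩ := exists_onLoop_univ root
  obtain ⟨I, hI⟩ : ∃ I, bU ≤ B I := by
    obtain ⟨I, hI⟩ := pow_unbounded_of_one_lt (bU / b₀)
      (show (1 : ℝ≥0) < 4097 / 4096 by rw [one_lt_div (by norm_num)]; norm_num)
    exact ⟨I, ((div_le_iff₀' hb₀).1 hI.le)⟩
  let Y : ℕ → Finset V := fun i => if i < I then X (i + 1) else Finset.univ
  have hY : ∀ i < I, Y i = X (i + 1) := fun i hi => if_pos hi
  have hYI : Y I = Finset.univ := if_neg (lt_irrefl _)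
  have hYmono : Monotone Y := by
    intro i j hij
    by_cases hj : j < I
    · rw [hY j hj, hY i (hij.trans_lt hj)]
      exact hXmono (Nat.succ_le_succ hij)
    · simp only [Y, hj, if_false]
      exact Finset.subset_univ _
  have hYloop : ∀ i, OnLoop root (Y i) ((49160 * 4097 * B i : ℝ≥0) : ℝ≥0∞) := by
    intro i
    by_cases hi : i < I
    · rw [hY i hi]; exact hXloop' i
    · simp only [Y, hi, if_false]
      refine hbU.mono subset_rfl ?_
      have h1 : bU ≤ B i := hI.trans (budget_mono b₀ (not_lt.1 hi))
      exact_mod_cast h1.trans (le_mul_of_one_le_left zero_le (by norm_num))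
  have hk : k ≤ (Y I).card := by
    rw [hYI, ← hP₀ 0]; exact Finset.card_le_univ _
  obtain ⟨P, hP, hPn, hPc⟩ := exists_nonAdaptive_of_phases (k := k) (I := I) hYmono hYloop
    (fun i => 73729 * B i) hk
  refine ⟨P, hP, hPn, ?_⟩
  -- the event that the phases before the `i`-th one have failed
  let Ev : ℕ → Set (V → ℝ≥0) := fun i =>
    Nat.casesOn i Set.univ fun j => {c | ¬ Cheap (X (j + 1)) k (73729 * B j) c}
  have hEvm : ∀ i, MeasurableSet (Ev i) := by
    rintro (_ | j)
    · exact .univ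
    · exact (measurableSet_cheap _ _ _).compl
  have hEv : ∀ i ≤ I, ∀ c, (∀ j < i, ¬ Cheap (Y j) k (73729 * B j) c) → c ∈ Ev i := by
    rintro (_ | j) hi c hc
    · trivial
    · have := hc j (Nat.lt_succ_self j)
      rw [hY j hi] at this
      exact this
  set K : ℝ≥0 := 49160 * 4097 * 8194 + 73729 with hK
  have hwalk : ∀ i, ∑ j ∈ Finset.range (i + 2), ((49160 * 4097 * B j : ℝ≥0) : ℝ≥0∞) +
      ((73729 * B i : ℝ≥0) : ℝ≥0∞) ≤ ((K * B i : ℝ≥0) : ℝ≥0∞) := by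
    intro i
    have h1 := sum_budget_le b₀ (i + 1)
    have h2 : B (i + 1) ≤ 2 * B i := by
      rw [hB, budget_succ]
      gcongr
      rw [div_le_iff₀ (by norm_num)]; norm_num
    have h3 : ∑ j ∈ Finset.range (i + 2), 49160 * 4097 * B j + 73729 * B i ≤ K * B i := by
      rw [← Finset.mul_sum]
      calc 49160 * 4097 * ∑ j ∈ Finset.range (i + 2), B j + 73729 * B i
          ≤ 49160 * 4097 * (4097 * (2 * B i)) + 73729 * B i := by
            gcongr; exact h1.trans (by gcongr)
        _ = K * B i := by rw [hK]; ring
    exact_mod_cast h3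
  have hpt : ∀ c, P.totalCost c ≤ ∑ i ∈ Finset.range (I + 1),
      (Ev i).indicator (fun _ => ((K * B i : ℝ≥0) : ℝ≥0∞)) c + P₀.totalCost c := by
    intro c
    rcases hPc c with ⟨i, hi, hfail, hle⟩ | ⟨hfail, hle⟩
    · refine (hle.trans (hwalk i)).trans (le_trans ?_ le_self_add)
      have hmem := hEv i hi.le c hfail
      refine le_trans ?_ (Finset.single_le_sum (f := fun i =>
        (Ev i).indicator (fun _ => ((K * B i : ℝ≥0) : ℝ≥0∞)) c) (fun _ _ => zero_le)
        (Finset.mem_range.2 (Nat.lt_succ_of_lt hi)))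
      simp [hmem]
    · refine (hle (P₀.selected c) (by rw [hYI]; exact Finset.subset_univ _) (hP₀ c)).trans ?_
      refine add_le_add ((le_self_add.trans (hwalk I)).trans ?_) le_add_self
      have hmem := hEv I le_rfl c hfail
      refine le_trans ?_ (Finset.single_le_sum (f := fun i =>
        (Ev i).indicator (fun _ => ((K * B i : ℝ≥0) : ℝ≥0∞)) c) (fun _ _ => zero_le)
        (Finset.mem_range.2 (Nat.lt_succ_self I)))
      simp [hmem]
  set p : ℕ → ℝ := fun i => ν.real {c | B i < P₀.totalCost c} with hp
  set g : ℕ → ℝ := fun i => ν.real (Ev i) with hg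
  have hrec : ∀ i, g (i + 1) ≤ (1 - 1 / 2048) * g i + 1024 * p i := by
    intro i
    refine (hW i (X i)).trans ?_
    gcongr
    refine measureReal_mono ?_
    rcases i with _ | j
    · exact Set.subset_univ _
    · intro c hc hcheap
      refine hc (Cheap.mono_bound hcheap ?_)
      gcongr
      exact budget_mono b₀ (Nat.le_succ j)
  have hsum := sum_mul_le_of_recurrence (B := fun i => (B i : ℝ)) (g := g) (p := p)
    (fun i => (B i).2) (fun i => by simp [hB, budget_succ]) (by simp [hg, Ev])
    (fun i => measureReal_nonneg) (fun i => measureReal_nonneg) hrec I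
  have hBp : ∑ i ∈ Finset.range I, (B i : ℝ) * p i ≤ 8194 * b₀ := by
    have h1 : ∑ i ∈ Finset.range I, (B i : ℝ≥0∞) * ν {c | B i < P₀.totalCost c} ≤
        ((8194 * b₀ : ℝ≥0) : ℝ≥0∞) := by
      calc ∑ i ∈ Finset.range I, (B i : ℝ≥0∞) * ν {c | B i < P₀.totalCost c}
          = ∫⁻ c, ∑ i ∈ Finset.range I,
              (if (B i : ℝ≥0∞) < P₀.totalCost c then (B i : ℝ≥0∞) else 0) ∂ν := by
            have hm : ∀ i, MeasurableSet {c | (B i : ℝ≥0∞) < P₀.totalCost c} := fun i =>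
              measurableSet_lt measurable_const P₀.measurable_totalCost
            rw [lintegral_finsetSum _ fun i _ => Measurable.ite (hm i) measurable_const
              measurable_const]
            refine Finset.sum_congr rfl fun i _ => ?_
            rw [← lintegral_indicator_const (hm i)]
            refine lintegral_congr fun c => ?_
            simp [Set.indicator_apply]
        _ ≤ ∫⁻ c, 4097 * P₀.totalCost c ∂ν := lintegral_mono fun c => sum_budget_lt_le b₀ _ I
        _ = 4097 * P₀.expectedCost μ := lintegral_const_mul _ P₀.measurable_totalCost
        _ ≤ 4097 * (2 * b₀) := by gcongr
        _ = ((8194 * b₀ : ℝ≥0) : ℝ≥0∞) := by push_cast; rw [← mul_assoc]; norm_num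
    have h2 := ENNReal.toReal_mono ENNReal.coe_ne_top h1
    rw [ENNReal.toReal_sum fun i _ => ENNReal.mul_ne_top ENNReal.coe_ne_top
      (measure_ne_top _ _)] at h2
    simpa [ENNReal.toReal_mul, p, measureReal_def] using h2
  have hint : ∫⁻ c, ∑ i ∈ Finset.range (I + 1),
      (Ev i).indicator (fun _ => ((K * B i : ℝ≥0) : ℝ≥0∞)) c ∂ν ≤
      ((K * (4096 * (1 + 2048 * 8194)) * b₀ : ℝ≥0) : ℝ≥0∞) := by
    rw [lintegral_finsetSum _ fun i _ => measurable_const.indicator (hEvm i)]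
    simp only [lintegral_indicator_const (hEvm _)]
    refine (ENNReal.toReal_le_toReal (ENNReal.sum_ne_top.2 fun i _ => ENNReal.mul_ne_top
      ENNReal.coe_ne_top (measure_ne_top _ _)) ENNReal.coe_ne_top).1 ?_
    rw [ENNReal.toReal_sum fun i _ => ENNReal.mul_ne_top ENNReal.coe_ne_top (measure_ne_top _ _)]
    have h1 : ∑ i ∈ Finset.range (I + 1), (((K * B i : ℝ≥0) : ℝ≥0∞) * ν (Ev i)).toReal =
        K * ∑ i ∈ Finset.range (I + 1), (B i : ℝ) * g i := by
      rw [Finset.mul_sum]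
      refine Finset.sum_congr rfl fun i _ => ?_
      simp [ENNReal.toReal_mul, g, measureReal_def, mul_assoc]
    rw [h1]
    have h2 : (B 0 : ℝ) = b₀ := by simp [hB, budget]
    have h3 : ∑ i ∈ Finset.range (I + 1), (B i : ℝ) * g i ≤ 4096 * (1 + 2048 * 8194) * b₀ := by
      rw [h2] at hsum
      linarith
    have h4 := mul_le_mul_of_nonneg_left h3 (NNReal.coe_nonneg K)
    refine h4.trans (le_of_eq ?_)
    rw [ENNReal.coe_toReal]
    push_cast
    ring
  calc P.expectedCost μ ≤ ∫⁻ c, (∑ i ∈ Finset.range (I + 1),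
        (Ev i).indicator (fun _ => ((K * B i : ℝ≥0) : ℝ≥0∞)) c + P₀.totalCost c) ∂ν :=
        lintegral_mono hpt
    _ = (∫⁻ c, ∑ i ∈ Finset.range (I + 1),
        (Ev i).indicator (fun _ => ((K * B i : ℝ≥0) : ℝ≥0∞)) c ∂ν) + P₀.expectedCost μ :=
        lintegral_add_right _ P₀.measurable_totalCost
    _ ≤ ((K * (4096 * (1 + 2048 * 8194)) * b₀ : ℝ≥0) : ℝ≥0∞) + 2 * b₀ := add_le_add hint hcost
    _ = gapConstant * b₀ := by rw [gapConstant, ← hK]; push_cast; ring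

/-- If `OPT = 0`, then it is enough to visit the vertices at distance `0` from the root. -/
theorem exists_nonAdaptive_of_optCost_eq_zero {k : ℕ} (h0 : optCost root k μ = 0) :
    ∃ P : Policy V root, P.Feasible k ∧ P.NonAdaptive ∧ P.expectedCost μ = 0 := by
  classical
  set Z : Finset V := {v | edist root v = 0} with hZ
  have hcheap : ∀ x : ℝ≥0, 0 < x → (∀ v ∉ Z, (x : ℝ≥0∞) < edist root v) →
      ∀ᵐ c ∂Measure.pi μ, Cheap Z k x c := by
    intro x hx hxZ
    have hle : (x : ℝ≥0∞) * Measure.pi μ {c | ¬ Cheap Z k x c} ≤ optCost root k μ := by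
      refine le_iInf₂ fun P hP => ?_
      refine le_trans ?_ (mul_meas_ge_le_lintegral P.measurable_totalCost x)
      refine mul_le_mul' le_rfl (measure_mono fun c hc => ?_)
      by_contra hcon
      have hle : P.totalCost c ≤ x := (not_le.1 hcon).le
      refine hc ⟨P.selected c, fun v hv => ?_, hP c, Policy.sum_selected_le hle⟩
      by_contra hvZ
      obtain ⟨n, f, f0, hf, hfx⟩ := Policy.onWalk_exploration (P := P) (B := x) c
      obtain ⟨s, hs, rfl⟩ := hf v (Policy.selected_subset_visited hle hv)
      refine absurd (hxZ _ hvZ) (not_lt.2 ?_)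
      rw [← f0]
      exact (edist_le_range_sum_edist f s).trans
        ((Finset.sum_le_sum_of_subset (Finset.range_mono hs)).trans hfx)
    rw [h0, nonpos_iff_eq_zero, mul_eq_zero] at hle
    exact hle.resolve_left (by simpa using hx.ne')
  -- every positive distance exceeds `1 / n` for large `n`
  have hev : ∀ᶠ n : ℕ in Filter.atTop, ∀ v ∉ Z, (n : ℝ≥0∞)⁻¹ < edist root v := by
    refine Filter.eventually_all.2 fun v => ?_
    by_cases hv : v ∈ Z
    · simp [hv]
    · have hpos : 0 < edist root v := pos_iff_ne_zero.2 fun h => hv (by simp [hZ, h])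
      filter_upwards [ENNReal.tendsto_inv_nat_nhds_zero.eventually (gt_mem_nhds hpos)] with n hn _
      exact hn
  obtain ⟨n₀, hn₀⟩ := Filter.eventually_atTop.1 hev
  have hall : ∀ᵐ c ∂Measure.pi μ, ∀ n : ℕ, n₀ < n → Cheap Z k (n : ℝ≥0)⁻¹ c := by
    refine ae_all_iff.2 fun n => ?_
    by_cases hn : n₀ < n
    · have hn0 : (0 : ℝ≥0) < n := by exact_mod_cast (Nat.zero_le _).trans_lt hn
      filter_upwards [hcheap (n : ℝ≥0)⁻¹ (inv_pos.2 hn0) fun v hv => by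
        rw [ENNReal.coe_inv hn0.ne']; exact_mod_cast hn₀ n hn.le v hv] with c hc _
      exact hc
    · exact .of_forall fun c h => absurd h hn
  have hk : k ≤ Z.card := by
    obtain ⟨c, hc⟩ := hall.exists
    obtain ⟨S, hS, hSk, -⟩ := hc (n₀ + 1) (Nat.lt_succ_self _)
    exact hSk ▸ Finset.card_le_card hS
  have hloop : OnLoop root Z 0 := by
    have := onLoop_of_edist_le (root := root) (W := Z) (b := 0) fun v hv =>
      (Finset.mem_filter.1 hv).2.le
    simpa using this
  obtain ⟨P, hP, hPn, hPc⟩ := exists_nonAdaptive_of_phases (root := root) (k := k) (I := 0)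
    (X := fun _ => Z) monotone_const (b := fun _ => 0) (fun _ => hloop) (fun _ => 0) hk
  refine ⟨P, hP, hPn, ?_⟩
  rw [Policy.expectedCost, lintegral_eq_zero_iff P.measurable_totalCost]
  filter_upwards [hall] with c hc
  rcases hPc c with ⟨i, hi, -⟩ | ⟨-, hle⟩
  · exact absurd hi (Nat.not_lt_zero i)
  · have hlim : P.totalCost c ≤ 0 := by
      refine ge_of_tendsto ENNReal.tendsto_inv_nat_nhds_zero
        ((Filter.eventually_gt_atTop n₀).mono fun n hn => ?_)
      obtain ⟨S, hS, hSk, hSx⟩ := hc n hn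
      have h1 := hle S hS hSk
      have hn0 : (n : ℝ≥0) ≠ 0 := by
        exact_mod_cast ((Nat.zero_le _).trans_lt hn).ne'
      have h2 : ∑ v ∈ S, (c v : ℝ≥0∞) ≤ (n : ℝ≥0∞)⁻¹ := by
        have h3 : ((∑ v ∈ S, c v : ℝ≥0) : ℝ≥0∞) ≤ (((n : ℝ≥0)⁻¹ : ℝ≥0) : ℝ≥0∞) :=
          ENNReal.coe_le_coe.2 hSx
        rw [ENNReal.coe_inv hn0] at h3
        push_cast at h3
        exact h3
      rw [Finset.sum_const_zero, zero_add] at h1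
      exact h1.trans h2
    exact nonpos_iff_eq_zero.1 hlim

end Assembly

end StochCostTSP

theorem theorem2 :
    ∃ C : ℝ≥0, ∀ (V : Type*) [Fintype V] [DecidableEq V] [PseudoMetricSpace V] (root : V) (k : ℕ)
      (μ : V → MeasureTheory.Measure ℝ≥0) [∀ v, MeasureTheory.IsProbabilityMeasure (μ v)],
      k ≤ Fintype.card V →
        ∃ P : StochCostTSP.Policy V root, P.Feasible k ∧ P.NonAdaptive ∧
          P.expectedCost μ ≤ (C : ℝ≥0∞) * StochCostTSP.optCost root k μ := by
  refine ⟨StochCostTSP.gapConstant, fun V _ _ _ root k μ _ hk => ?_⟩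
  have hC : (StochCostTSP.gapConstant : ℝ≥0∞) ≠ 0 := by
    rw [ENNReal.coe_ne_zero, StochCostTSP.gapConstant]; positivity
  rcases eq_or_ne (StochCostTSP.optCost root k μ) 0 with h0 | h0
  · obtain ⟨P, hP, hPn, hPc⟩ := StochCostTSP.exists_nonAdaptive_of_optCost_eq_zero h0
    exact ⟨P, hP, hPn, by simp [hPc]⟩
  rcases eq_or_ne (StochCostTSP.optCost root k μ) ⊤ with htop | htop
  -- if `OPT = ∞`, any feasible non-adaptive policy will do
  · obtain ⟨b, hb⟩ := StochCostTSP.exists_onLoop_univ root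
    obtain ⟨P, hP, hPn, -⟩ := StochCostTSP.exists_nonAdaptive_of_phases (k := k) (I := 0)
      (X := fun _ => Finset.univ) monotone_const (b := fun _ => b) (fun _ => hb) (fun _ => 0)
      (by simpa using hk)
    exact ⟨P, hP, hPn, by rw [htop, ENNReal.mul_top hC]; exact le_top⟩
  · obtain ⟨b₀, hb₀⟩ : ∃ b₀ : ℝ≥0, (b₀ : ℝ≥0∞) = StochCostTSP.optCost root k μ :=
      ⟨_, ENNReal.coe_toNNReal htop⟩
    have hlt : StochCostTSP.optCost root k μ < 2 * StochCostTSP.optCost root k μ := by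
      rw [two_mul]; exact ENNReal.lt_add_right htop h0
    obtain ⟨P₀, hP₀⟩ := iInf_lt_iff.1 hlt
    obtain ⟨hP₀, hcost⟩ := iInf_lt_iff.1 hP₀
    rw [← hb₀] at h0 hcost ⊢
    exact StochCostTSP.exists_nonAdaptive_of_pos
      (pos_iff_ne_zero.2 (ENNReal.coe_ne_zero.1 h0)) P₀ hP₀ hcost.le
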